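/- For every integer $N\ge 1$ consider the interactive binary model of dimension $N$ under the rare-events scaling: outcomes $y_{i,t}\in\{0,1\}$ and success probabilities $p_{i,t}\in[0,1]$, $i=1,\dots,N$, $t\in\mathbb Z$, such that, conditionally on $\mathcal I_{t-1}=\sigma(y_{j,\tau}:\ 1\le j\le N,\ \tau\le t-1)$, the variables $y_{1,t},\dots,y_{N,t}$ are independent Bernoulli with success probabilities $p_{1,t},\dots,p_{N,t}$, and $$p_{i,t}=\frac{c_i}{N}+\frac{a_i}{N^{\kappa}}\,y_{i,t-1}+\gamma_i\,\frac1N\sum_{j=1}^N y_{j,t-1}+\beta\, p_{i,t-1}\qquad\text{a.s.}$$ Here $\kappa>0$, $\beta\ge0$, and $(c_i),(a_i),(\gamma_i)$ are real sequences, not depending on $N$, with $0\le c_i,a_i\le C<\infty$ and $\gamma_i\ge0$ for all $i$; the limits $\bar c=\lim_{N\to\infty}\frac1N\sum_{i=1}^N c_i$ and $\bar\gamma=\lim_{N\to\infty}\frac1N\sum_{i=1}^N\gamma_i$ exist. A stationary solution is a process $(p_t,y_t)_{t\in\mathbb Z}$ with these properties whose joint law is invariant under all time shifts. Suppose that there is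 a constant $\bar C<1$ with $\beta+\gamma_i<\bar C$ for all $i$. Then: (1) For all sufficiently large $N$, one has $\frac{c_i}{N}+\frac{a_i}{N^\kappa}+\gamma_i+\beta\le1$ for all $i\le N$, and the model has a stationary solution, which is unique in law. (2) There is a random variable $\lambda_0$ with finite mean, whose law depends only on the parameters, such that for any processes $(p_t^{(N)},y_t^{(N)})_{t\in\mathbb Z}$, each on its own probability space, that are stationary solutions of the $N$-dimensional model for all sufficiently large $N$, as $N\to\infty$, $$\sum_{i=1}^N p^{(N)}_{i,0}\xrightarrow{\ d\ }\lambda_0,\qquad \sum_{i=1}^N\mathbb E\,p^{(N)}_{i,0}\to\mathbb E\lambda_0,\qquad \max_{1\le i\le N}p^{(N)}_{i,0}\xrightarrow{\ p\ }0 .$$ -/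

import Mathlib

open MeasureTheory ProbabilityTheory Filter Topology

namespace InteractiveGAB

/-- The numerical value (`0` or `1`) of a binary outcome. -/
def val (b : Bool) : ℝ := if b then 1 else 0

/-- The parameters `ω_i, α_i, γ_i, β_i` of the `N`-dimensional interactive GAB(1,1) model. -/
structure Params (N : ℕ) where
  ω : Fin N → ℝ
  α : Fin N → ℝ
  γ : Fin N → ℝ
  β : Fin N → ℝ

/-- The parameter restrictions of the model, which keep the success probabilities in `[0,1]`. -/
def Params.Admissible {N : ℕ} (θ : Params N) : Prop :=
  ∀ i, 0 ≤ θ.ω i ∧ 0 ≤ θ.α i ∧ 0 ≤ θ.γ i ∧ 0 ≤ θ.β i ∧ θ.ω i + θ.α i + θ.γ i + θ.β i ≤ 1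

/-- The right-hand side of the recursion: the new success probabilities as a function of the
previous success probabilities and the previous outcomes. -/
noncomputable def Params.step {N : ℕ} (θ : Params N) (p : Fin N → ℝ) (y : Fin N → Bool) :
    Fin N → ℝ :=
  fun i => θ.ω i + θ.α i * val (y i) + θ.γ i * ((1 / (N : ℝ)) * ∑ j, val (y j)) + θ.β i * p i

/-- The information `σ(y_τ, τ ≤ t)` available at time `t`. -/
abbrev info {Ω : Type*} {N : ℕ} (y : ℤ → Ω → Fin N → Bool) (t : ℤ) : MeasurableSpace Ω :=
  ⨆ τ : ℤ, ⨆ _ : τ ≤ t, MeasurableSpace.comap (y τ) inferInstance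

/-- Trajectories `t ↦ (p_t, y_t)`, indexed by all integer times. -/
abbrev Path (N : ℕ) : Type := ℤ → (Fin N → ℝ) × (Fin N → Bool)

/-- The random trajectory of a pair of processes. -/
def trajectory {Ω : Type*} {N : ℕ} (p : ℤ → Ω → Fin N → ℝ) (y : ℤ → Ω → Fin N → Bool) :
    Ω → Path N :=
  fun ω t => (p t ω, y t ω)

/-- `(p_t, y_t)`, `t ∈ ℤ`, solves the interactive GAB(1,1) model with parameters `θ`. -/
structure IsSolution {Ω : Type*} [MeasurableSpace Ω] {N : ℕ} (θ : Params N) (μ : Measure Ω)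
    (p : ℤ → Ω → Fin N → ℝ) (y : ℤ → Ω → Fin N → Bool) : Prop where
  measurable_p : ∀ t, Measurable (p t)
  measurable_y : ∀ t, Measurable (y t)
  mem_Icc : ∀ t, ∀ᵐ ω ∂μ, ∀ i, p t ω i ∈ Set.Icc (0 : ℝ) 1
  /-- Given the past outcomes, the `y_{i,t}` are independent Bernoulli with parameters `p_{i,t}`. -/
  cond_law : ∀ t, ∀ b : Fin N → Bool,
    μ[Set.indicator {ω | y t ω = b} (fun _ => (1 : ℝ)) | info y (t - 1)]
      =ᵐ[μ] fun ω => ∏ i, (if b i then p t ω i else 1 - p t ω i)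
  recursion : ∀ t, ∀ᵐ ω ∂μ, p t ω = θ.step (p (t - 1) ω) (y (t - 1) ω)

/-- A strictly stationary solution: a solution whose joint law is invariant under time shifts. -/
structure IsStationarySolution {Ω : Type*} [MeasurableSpace Ω] {N : ℕ} (θ : Params N)
    (μ : Measure Ω) (p : ℤ → Ω → Fin N → ℝ) (y : ℤ → Ω → Fin N → Bool) : Prop
    extends IsSolution θ μ p y where
  stationary : ∀ h : ℤ,
    μ.map (trajectory (fun t => p (t + h)) (fun t => y (t + h))) = μ.map (trajectory p y)

/-- The model has a unique (in law) strictly stationary solution on a probability space: there is a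
law `P` on trajectories under which the coordinate process is a stationary solution, and every
stationary solution on any probability space has the law `P`. -/
def HasUniqueStationarySolution {N : ℕ} (θ : Params N) : Prop :=
  ∃ P : Measure (Path N), IsProbabilityMeasure P ∧
    IsStationarySolution θ P (fun t x => (x t).1) (fun t x => (x t).2) ∧
    ∀ (Ω : Type*) [MeasurableSpace Ω] (μ : Measure Ω) [IsProbabilityMeasure μ]
      (p : ℤ → Ω → Fin N → ℝ) (y : ℤ → Ω → Fin N → Bool),
      IsStationarySolution θ μ p y → μ.map (trajectory p y) = P

/-- The rare-events parameters `ω_i = c_i / N`, `α_i = a_i / N ^ κ`, `γ_i`, `β_i = β` (with `i`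
counted from `0`). -/
noncomputable def rareEvents (c a γ : ℕ → ℝ) (β κ : ℝ) (N : ℕ) : Params N where
  ω i := c i / (N : ℝ)
  α i := a i / (N : ℝ) ^ κ
  γ i := γ i
  β _ := β

/-- The initial-condition requirements on random vectors `p_{·,0} = q N` (one for each `N`, on its
own probability space), where `ν` is the law of the limit variable `λ₀`: the sum `∑ p_{i,0}`
converges in law and in mean to `λ₀`, and `max p_{i,0}` converges to `0` in probability. -/
structure InitialCondition {Ω : ℕ → Type*} [∀ N, MeasurableSpace (Ω N)]
    (μ : ∀ N, Measure (Ω N)) [∀ N, IsProbabilityMeasure (μ N)]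
    (q : ∀ N, Ω N → Fin N → ℝ) (ν : Measure ℝ) [IsProbabilityMeasure ν] : Prop where
  tendsto_law : TendstoInDistribution (fun N ω => ∑ i, q N ω i) atTop (fun x : ℝ => x) μ ν
  integrable_limit : Integrable (fun x : ℝ => x) ν
  tendsto_mean : Tendsto (fun N => ∑ i, ∫ ω, q N ω i ∂(μ N)) atTop (𝓝 (∫ x, x ∂ν))
  tendsto_max : ∀ ε : ℝ, 0 < ε →
    Tendsto (fun N => μ N {ω | ε ≤ |⨆ i, q N ω i|}) atTop (𝓝 0)

end InteractiveGAB

/-! ### Bernoulli weights, the threshold coupling and the ℓ¹ contraction. -/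

namespace InteractiveGAB

variable {N : ℕ}

/-! Existence and uniqueness. Outcomes can be realised by thresholding: outcome i is a success when
a uniform variable lies below p_i. If two probability vectors p, q use the same uniforms, their
outcomes differ at j with probability |p_j - q_j|. Such a difference costs at most α_j + (1/N) ∑ γ_i
in the ℓ¹ norm of the next vector, and the old vector itself contributes β_j |p_j - q_j|. For large
N the transition operator therefore shrinks ℓ¹ Lipschitz constants by the factor (1 + Cbar)/2 < 1
(`Params.lipCube_Q`). Cylinder probabilities of the outcomes are expectations of Lipschitz functions
of p_t, and looking back m steps determines them up to a geometric error. Hence any two solutions,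
stationary or not, have the same outcome law, and the same joint law because p_t is a function of
the past outcomes. One solution is then enough: its time shifts are solutions too, so its law is
stationary. It is built from i.i.d. uniforms as the increasing limit of the models started from 0
ever further in the past (`Params.isSolution_minimal`).

Limit. Stationarity bounds E ∑ p_i uniformly in N and gives E max p_i = O(1/N + N^(-κ)). Given S = ∑
p_i, the number of successes is then nearly Poisson with mean S, so ψ_N(z) = E exp(zS) satisfies,
for Re z ≤ 0, ψ_N(z) ≈ exp(z cbar) ψ_N(Tz) with Tz = βz + exp(gz) - 1 and g the limit of the
averages of γ (`RareBounds.norm_integral_exp_sub_le`). This is the stationarity equation of the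
Poisson autoregression λ' = cbar + βλ + g Poisson(λ). Bounded means give tightness, and a
subsequential limit solves the equation exactly. Since |Tz| ≤ (g + β)|z| with g + β < 1, and all
transforms are close to 1 near 0, iterating the equation makes the whole sequence converge to that
limit (`exists_tendsto_of_laplace`). Differentiating the equation at 0 gives the mean cbar / (1 - g
- β), which is also the limit of the means E ∑ p_i. -/

lemma val_nonneg (b : Bool) : 0 ≤ val b := by cases b <;> simp [val]

lemma val_le_one (b : Bool) : val b ≤ 1 := by cases b <;> simp [val]

/-- The set of vectors of probabilities. -/
def cube (N : ℕ) : Set (Fin N → ℝ) := {p | ∀ i, p i ∈ Set.Icc (0 : ℝ) 1}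

lemma zero_mem_cube : (0 : Fin N → ℝ) ∈ cube N := fun _ => by simp

lemma measurableSet_cube : MeasurableSet (cube N) := by
  have : cube N = Set.univ.pi fun _ => Set.Icc (0 : ℝ) 1 := by
    ext; simp only [cube, Set.mem_ofPred_eq, Set.mem_univ_pi]
  rw [this]
  exact MeasurableSet.univ_pi fun _ => measurableSet_Icc

/-- The `ℓ¹` distance. -/
def dist1 (p q : Fin N → ℝ) : ℝ := ∑ i, |p i - q i|

lemma dist1_le_card {p q : Fin N → ℝ} (hp : p ∈ cube N) (hq : q ∈ cube N) : dist1 p q ≤ N := by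
  have : dist1 p q ≤ ∑ _i : Fin N, (1 : ℝ) := Finset.sum_le_sum fun i _ => by
    have := hp i; have := hq i
    simp only [Set.mem_Icc] at *
    rw [abs_le]; constructor <;> linarith
  simpa using this

/-- The probability of the outcome `b` under independent Bernoulli laws with parameters `p`. -/
def weight (p : Fin N → ℝ) (b : Fin N → Bool) : ℝ := ∏ i, (if b i then p i else 1 - p i)

lemma weight_nonneg {p : Fin N → ℝ} (hp : p ∈ cube N) (b : Fin N → Bool) : 0 ≤ weight p b :=
  Finset.prod_nonneg fun i _ => by
    have := hp i
    simp only [Set.mem_Icc] at this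
    split_ifs <;> linarith

lemma weight_le_one {p : Fin N → ℝ} (hp : p ∈ cube N) (b : Fin N → Bool) : weight p b ≤ 1 :=
  Finset.prod_le_one (fun i _ => by
    have := hp i
    simp only [Set.mem_Icc] at this
    split_ifs <;> linarith) fun i _ => by
    have := hp i
    simp only [Set.mem_Icc] at this
    split_ifs <;> linarith

lemma continuous_weight (b : Fin N → Bool) : Continuous fun p : Fin N → ℝ => weight p b := by
  unfold weight
  refine continuous_finsetProd _ fun i _ => ?_
  split_ifs <;> fun_prop

/-- Factors are exchanged one at a time; all the others have norm at most 1. It serves both the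
Lipschitz bound for `weight` and the Poisson approximation. -/
lemma norm_prod_sub_prod_le {ι R : Type*} [NormedField R] (s : Finset ι) (f g : ι → R)
    (hf : ∀ i, ‖f i‖ ≤ 1) (hg : ∀ i, ‖g i‖ ≤ 1) :
    ‖∏ i ∈ s, f i - ∏ i ∈ s, g i‖ ≤ ∑ i ∈ s, ‖f i - g i‖ := by
  classical
  induction s using Finset.induction_on with
  | empty => simp
  | insert a s ha ih =>
    rw [Finset.prod_insert ha, Finset.prod_insert ha, Finset.sum_insert ha]
    have e : f a * ∏ i ∈ s, f i - g a * ∏ i ∈ s, g i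
        = (f a - g a) * ∏ i ∈ s, f i + g a * (∏ i ∈ s, f i - ∏ i ∈ s, g i) := by ring
    rw [e]
    refine (norm_add_le _ _).trans (add_le_add ?_ ?_)
    · rw [norm_mul, norm_prod]
      exact mul_le_of_le_one_right (norm_nonneg _)
        (Finset.prod_le_one (fun i _ => norm_nonneg _) fun i _ => hf i)
    · rw [norm_mul]
      exact (mul_le_of_le_one_left (norm_nonneg _) (hg a)).trans ih

lemma abs_weight_sub_le {p q : Fin N → ℝ} (hp : p ∈ cube N) (hq : q ∈ cube N)
    (b : Fin N → Bool) : |weight p b - weight q b| ≤ dist1 p q := by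
  have key : ∀ {p : Fin N → ℝ}, p ∈ cube N → ∀ i, ‖if b i then p i else 1 - p i‖ ≤ 1 := by
    intro p hp i
    have := hp i
    simp only [Set.mem_Icc] at this
    rw [Real.norm_eq_abs, abs_le]
    split_ifs <;> constructor <;> linarith
  refine (norm_prod_sub_prod_le _ _ _ (key hp) (key hq)).trans (Finset.sum_le_sum fun i _ => ?_)
  rw [Real.norm_eq_abs]
  split_ifs
  · exact le_rfl
  · rw [abs_sub_comm (p i)]; exact le_of_eq (by ring_nf)

/-- Sums of products against the Bernoulli weights factorize. -/
lemma sum_weight_mul_prod (p : Fin N → ℝ) (h : Fin N → Bool → ℂ) :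
    ∑ b : Fin N → Bool, (weight p b : ℂ) * ∏ i, h i (b i)
      = ∏ i, ((p i : ℂ) * h i true + (1 - p i) * h i false) := by
  have := Finset.prod_univ_sum (R := ℂ) (fun _ : Fin N => (Finset.univ : Finset Bool))
    (fun i b => ((if b then p i else 1 - p i : ℝ) : ℂ) * h i b)
  simp only [Fintype.piFinset_univ, Finset.prod_mul_distrib] at this
  simp only [weight, Complex.ofReal_prod]
  rw [← this]
  refine Finset.prod_congr rfl fun i _ => ?_
  simp

lemma sum_weight (p : Fin N → ℝ) : ∑ b : Fin N → Bool, weight p b = 1 := by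
  have := sum_weight_mul_prod p fun _ _ => 1
  simp only [Finset.prod_const_one, mul_one, add_sub_cancel] at this
  exact_mod_cast this

lemma sum_weight_mul_val (p : Fin N → ℝ) (j : Fin N) :
    ∑ b : Fin N → Bool, weight p b * val (b j) = p j := by
  have := sum_weight_mul_prod p fun i b => if i = j then (val b : ℂ) else 1
  simp only [Finset.prod_ite_eq', Finset.mem_univ, if_true] at this
  have e : ∀ i, (p i : ℂ) * (if i = j then (val true : ℂ) else 1)
      + (1 - p i) * (if i = j then (val false : ℂ) else 1) = if i = j then (p i : ℂ) else 1 := by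
    intro i; split_ifs <;> simp [val]
  simp only [e, Finset.prod_ite_eq', Finset.mem_univ, if_true] at this
  exact_mod_cast this

/-- The outcomes produced by comparing uniform variables `u` with the success probabilities. -/
noncomputable def thr (p u : Fin N → ℝ) : Fin N → Bool := fun i => decide (u i < p i)

/-- The uniform law on `[0,1] ^ N`. -/
noncomputable def unif (N : ℕ) : Measure (Fin N → ℝ) :=
  Measure.pi fun _ => volume.restrict (Set.Icc (0 : ℝ) 1)

instance : IsProbabilityMeasure ((volume : Measure ℝ).restrict (Set.Icc (0 : ℝ) 1)) :=
  ⟨by simp⟩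

instance : IsProbabilityMeasure (unif N) := by unfold unif; infer_instance

lemma measurable_thr : Measurable fun x : (Fin N → ℝ) × (Fin N → ℝ) => thr x.1 x.2 := by
  refine measurable_pi_lambda _ fun i => ?_
  refine measurable_to_bool ?_
  have : (fun x : (Fin N → ℝ) × (Fin N → ℝ) => thr x.1 x.2 i) ⁻¹' {true}
      = {x | x.2 i < x.1 i} := by ext; simp [thr]
  rw [this]
  exact measurableSet_lt (by fun_prop) (by fun_prop)

lemma unif_thr {p : Fin N → ℝ} (hp : p ∈ cube N) (b : Fin N → Bool) :
    unif N {u | thr p u = b} = ENNReal.ofReal (weight p b) := by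
  have : {u | thr p u = b} = Set.univ.pi fun i => {x : ℝ | decide (x < p i) = b i} := by
    ext u; simp [thr, funext_iff]
  rw [this, unif, Measure.pi_pi, weight, ENNReal.ofReal_prod_of_nonneg]
  · refine Finset.prod_congr rfl fun i _ => ?_
    have h := hp i
    cases hb : b i
    · have : {x : ℝ | decide (x < p i) = false} = Set.Ici (p i) := by ext; simp
      rw [this, Measure.restrict_apply measurableSet_Ici]
      have : Set.Ici (p i) ∩ Set.Icc 0 1 = Set.Icc (p i) 1 := by
        ext x; simp only [Set.mem_inter_iff, Set.mem_Ici, Set.mem_Icc]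
        exact ⟨fun h => ⟨h.1, h.2.2⟩, fun h' => ⟨h'.1, h.1.trans h'.1, h'.2⟩⟩
      simp [this]
    · have : {x : ℝ | decide (x < p i) = true} = Set.Iio (p i) := by ext; simp
      rw [this, Measure.restrict_apply measurableSet_Iio]
      have : Set.Iio (p i) ∩ Set.Icc 0 1 = Set.Ico 0 (p i) := by
        ext x; simp only [Set.mem_inter_iff, Set.mem_Iio, Set.mem_Icc, Set.mem_Ico]
        exact ⟨fun h => ⟨h.2.1, h.1⟩, fun h' => ⟨h'.2, h'.1, h'.2.le.trans h.2⟩⟩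
      simp [this]
  · intro i _
    have := hp i
    simp only [Set.mem_Icc] at this
    split_ifs <;> linarith

lemma integral_thr {p : Fin N → ℝ} (hp : p ∈ cube N) (g : (Fin N → Bool) → ℝ) :
    ∫ u, g (thr p u) ∂unif N = ∑ b, weight p b * g b := by
  have hm : Measurable (thr p) := measurable_thr.comp measurable_prodMk_left
  rw [← integral_map (f := g) hm.aemeasurable (by fun_prop), integral_fintype]
  · refine Finset.sum_congr rfl fun b _ => ?_
    rw [measureReal_def, Measure.map_apply hm (measurableSet_singleton b)]
    have : thr p ⁻¹' {b} = {u | thr p u = b} := rfl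
    rw [this, unif_thr hp, ENNReal.toReal_ofReal (weight_nonneg hp b), smul_eq_mul]
  · have := Measure.isProbabilityMeasure_map (μ := unif N) hm.aemeasurable
    exact Integrable.of_finite

lemma integrable_thr (p q : Fin N → ℝ)
    (f : (Fin N → Bool) → (Fin N → Bool) → ℝ) :
    Integrable (fun u => f (thr p u) (thr q u)) (unif N) := by
  have hm : ∀ p, Measurable (thr (N := N) p) := fun p => measurable_thr.comp measurable_prodMk_left
  have : Measurable fun x : (Fin N → Bool) × (Fin N → Bool) => f x.1 x.2 := measurable_of_finite _
  refine Integrable.of_bound (C := ∑ a, ∑ b, |f a b|)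
    (this.comp ((hm p).prodMk (hm q))).aestronglyMeasurable (ae_of_all _ fun u => ?_)
  refine le_trans ?_ (Finset.single_le_sum (f := fun a => ∑ b, |f a b|)
    (fun a _ => Finset.sum_nonneg fun b _ => abs_nonneg _) (Finset.mem_univ (thr p u)))
  exact Finset.single_le_sum (f := fun b => |f (thr p u) b|)
    (fun b _ => abs_nonneg _) (Finset.mem_univ (thr q u))

/-- Common uniforms make the outcomes monotone in the probabilities, so the absolute value can be
removed and the expected discrepancy is a difference of means. -/
lemma integral_abs_val_thr_sub {p q : Fin N → ℝ} (hp : p ∈ cube N) (hq : q ∈ cube N) (j : Fin N) :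
    ∫ u, |val (thr p u j) - val (thr q u j)| ∂unif N = |p j - q j| := by
  have key : ∀ {p q : Fin N → ℝ}, p ∈ cube N → q ∈ cube N → p j ≤ q j →
      ∫ u, |val (thr p u j) - val (thr q u j)| ∂unif N = |p j - q j| := by
    intro p q hp hq h
    have e : ∀ u, |val (thr p u j) - val (thr q u j)| = val (thr q u j) - val (thr p u j) := by
      intro u
      rw [abs_sub_comm, abs_of_nonneg]
      simp only [thr, val, decide_eq_true_eq]
      split_ifs <;> linarith
    simp only [e]
    have i := fun p : Fin N → ℝ => integrable_thr p p fun a _ => val (a j)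
    rw [integral_sub (i q) (i p), integral_thr hp fun b => val (b j),
      integral_thr hq fun b => val (b j), sum_weight_mul_val, sum_weight_mul_val,
      abs_sub_comm, abs_of_nonneg (by linarith)]
  rcases le_total (p j) (q j) with h | h
  · exact key hp hq h
  · rw [abs_sub_comm, ← key hq hp h]
    simp only [abs_sub_comm]

variable {θ : Params N}

lemma Params.Admissible.β_le_one (hθ : θ.Admissible) (i : Fin N) : θ.β i ≤ 1 := by
  obtain ⟨h1, h2, h3, h4, h5⟩ := hθ i; linarith

lemma mean_val_mem (y : Fin N → Bool) :
    (1 / (N : ℝ)) * ∑ j, val (y j) ∈ Set.Icc (0 : ℝ) 1 := by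
  constructor
  · exact mul_nonneg (by positivity) (Finset.sum_nonneg fun _ _ => val_nonneg _)
  · have : ∑ j, val (y j) ≤ N := by
      simpa using Finset.sum_le_sum fun j (_ : j ∈ Finset.univ) => val_le_one (y j)
    rw [one_div]
    exact (mul_le_mul_of_nonneg_left this (by positivity)).trans inv_mul_le_one

lemma Params.step_mem_cube (hθ : θ.Admissible) {p : Fin N → ℝ} (hp : p ∈ cube N)
    (y : Fin N → Bool) : θ.step p y ∈ cube N := by
  intro i
  obtain ⟨h1, h2, h3, h4, h5⟩ := hθ i
  have a := mul_nonneg h2 (val_nonneg (y i))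
  have b := mul_nonneg h3 (mean_val_mem y).1
  have c := mul_nonneg h4 (hp i).1
  have a' := mul_le_of_le_one_right h2 (val_le_one (y i))
  have b' := mul_le_of_le_one_right h3 (mean_val_mem y).2
  have c' := mul_le_of_le_one_right h4 (hp i).2
  simp only [Params.step]
  constructor <;> linarith

lemma Params.step_mono (hθ : θ.Admissible) {p q : Fin N → ℝ} {y z : Fin N → Bool} (hpq : p ≤ q)
    (hyz : ∀ i, val (y i) ≤ val (z i)) : θ.step p y ≤ θ.step q z := by
  intro i
  obtain ⟨h1, h2, h3, h4, h5⟩ := hθ i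
  have := hpq i
  have := hyz i
  have : ∑ j, val (y j) ≤ ∑ j, val (z j) := Finset.sum_le_sum fun j _ => hyz j
  simp only [Params.step]
  gcongr

lemma Params.continuous_step (y : Fin N → Bool) : Continuous fun p => θ.step p y := by
  unfold Params.step; fun_prop

lemma Params.measurable_step :
    Measurable fun x : (Fin N → ℝ) × (Fin N → Bool) => θ.step x.1 x.2 := by
  have : Measurable val := measurable_of_finite _
  unfold Params.step; fun_prop

/-- The transition operator is an `ℓ¹` contraction with constant `ρ`. -/
def Params.Contracting (θ : Params N) (ρ : ℝ) : Prop :=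
  ∀ j, θ.α j + (1 / (N : ℝ)) * ∑ i, θ.γ i + θ.β j ≤ ρ

/-- Summation over the affected index i first: a change of y_j moves coordinate j by α_j and every
coordinate i by γ_i / N, which gives the column sums of `Params.Contracting`. -/
lemma Params.dist1_step_le (hθ : θ.Admissible) (p q : Fin N → ℝ) (y z : Fin N → Bool) :
    dist1 (θ.step p y) (θ.step q z)
      ≤ ∑ j, ((θ.α j + (1 / (N : ℝ)) * ∑ i, θ.γ i) * |val (y j) - val (z j)|
          + θ.β j * |p j - q j|) := by
  have h : ∀ i, |θ.step p y i - θ.step q z i| ≤ θ.α i * |val (y i) - val (z i)|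
      + θ.γ i * ((1 / (N : ℝ)) * ∑ j, |val (y j) - val (z j)|) + θ.β i * |p i - q i| := by
    intro i
    obtain ⟨h1, h2, h3, h4, h5⟩ := hθ i
    have e : θ.step p y i - θ.step q z i = θ.α i * (val (y i) - val (z i))
      + θ.γ i * ((1 / (N : ℝ)) * ∑ j, (val (y j) - val (z j))) + θ.β i * (p i - q i) := by
      simp only [Params.step, Finset.sum_sub_distrib]; ring
    rw [e]
    refine (abs_add_le _ _).trans (add_le_add ((abs_add_le _ _).trans (add_le_add ?_ ?_)) ?_)
    · rw [abs_mul, abs_of_nonneg h2]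
    · rw [abs_mul, abs_of_nonneg h3, abs_mul, abs_of_nonneg (by positivity : 0 ≤ 1 / (N : ℝ))]
      gcongr
      exact Finset.abs_sum_le_sum_abs _ _
    · rw [abs_mul, abs_of_nonneg h4]
  refine (Finset.sum_le_sum fun i _ => h i).trans (le_of_eq ?_)
  simp only [Finset.sum_add_distrib, add_mul]
  rw [← Finset.sum_mul, ← Finset.mul_sum]
  ring

/-- The transition operator of the success probabilities. -/
noncomputable def Params.Q (θ : Params N) (f : (Fin N → ℝ) → ℝ) (p : Fin N → ℝ) : ℝ :=
  ∑ b, weight p b * f (θ.step p b)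

/-- Lipschitz continuity on the cube for the `ℓ¹` distance. -/
def LipCube (f : (Fin N → ℝ) → ℝ) (L : ℝ) : Prop :=
  ∀ p ∈ cube N, ∀ q ∈ cube N, |f p - f q| ≤ L * dist1 p q

/-- Both averages over outcomes are written as integrals over the same uniforms, where the pathwise
bound `Params.dist1_step_le` and the coupling identity combine. -/
lemma Params.lipCube_Q (hθ : θ.Admissible) {ρ : ℝ} (hρ : θ.Contracting ρ)
    {f : (Fin N → ℝ) → ℝ} {L : ℝ} (hL : 0 ≤ L) (hf : LipCube f L) :
    LipCube (θ.Q f) (ρ * L) := by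
  intro p hp q hq
  have i1 := fun p : Fin N → ℝ => integrable_thr p p fun a _ => f (θ.step p a)
  rw [Params.Q, Params.Q, ← integral_thr hp fun b => f (θ.step p b),
    ← integral_thr hq fun b => f (θ.step q b), ← integral_sub (i1 p) (i1 q)]
  refine (abs_integral_le_integral_abs).trans ?_
  set A : Fin N → ℝ := fun j => θ.α j + (1 / (N : ℝ)) * ∑ i, θ.γ i
  calc ∫ u, |f (θ.step p (thr p u)) - f (θ.step q (thr q u))| ∂unif N
      ≤ ∫ u, L * ∑ j, (A j * |val (thr p u j) - val (thr q u j)| + θ.β j * |p j - q j|) ∂unif N := by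
        refine integral_mono (integrable_thr p q
          fun a b => |f (θ.step p a) - f (θ.step q b)|)
          (integrable_thr p q fun a b =>
            L * ∑ j, (A j * |val (a j) - val (b j)| + θ.β j * |p j - q j|)) fun u => ?_
        exact (hf _ (θ.step_mem_cube hθ hp _) _ (θ.step_mem_cube hθ hq _)).trans
          (mul_le_mul_of_nonneg_left (θ.dist1_step_le hθ p q _ _) hL)
    _ = L * ∑ j, (A j * |p j - q j| + θ.β j * |p j - q j|) := by
        rw [integral_const_mul, integral_finsetSum _ fun j _ =>
          integrable_thr p q fun a b =>
            A j * |val (a j) - val (b j)| + θ.β j * |p j - q j|]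
        congr 1
        refine Finset.sum_congr rfl fun j _ => ?_
        rw [integral_add (integrable_thr p q fun a b => A j * |val (a j) - val (b j)|)
          (integrable_const _), integral_const_mul, integral_abs_val_thr_sub hp hq]
        simp
    _ ≤ L * ∑ j, ρ * |p j - q j| := by
        gcongr with j
        rw [← add_mul]
        exact mul_le_mul_of_nonneg_right (hρ j) (abs_nonneg _)
    _ = ρ * L * dist1 p q := by rw [← Finset.mul_sum, dist1]; ring

lemma Params.lipCube_Q_iterate (hθ : θ.Admissible) {ρ : ℝ} (hρ0 : 0 ≤ ρ) (hρ : θ.Contracting ρ)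
    {f : (Fin N → ℝ) → ℝ} {L : ℝ} (hL : 0 ≤ L) (hf : LipCube f L) (m : ℕ) :
    LipCube (θ.Q^[m] f) (ρ ^ m * L) := by
  induction m with
  | zero => simpa using hf
  | succ m ih =>
    rw [Function.iterate_succ_apply', pow_succ', mul_assoc]
    exact θ.lipCube_Q hθ hρ (by positivity) ih

/-- The probability that the next `n` outcomes are `b 0, …, b (n - 1)`, given the current success
probabilities. -/
noncomputable def Params.F (θ : Params N) : ℕ → (ℕ → Fin N → Bool) → (Fin N → ℝ) → ℝ
  | 0, _, _ => 1
  | n + 1, b, p => weight p (b 0) * θ.F n (fun k => b (k + 1)) (θ.step p (b 0))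

lemma Params.F_mem (hθ : θ.Admissible) (n : ℕ) (b : ℕ → Fin N → Bool) {p : Fin N → ℝ}
    (hp : p ∈ cube N) : θ.F n b p ∈ Set.Icc (0 : ℝ) 1 := by
  induction n generalizing b p with
  | zero => simp [Params.F]
  | succ n ih =>
    have := ih (fun k => b (k + 1)) (θ.step_mem_cube hθ hp (b 0))
    exact ⟨mul_nonneg (weight_nonneg hp _) this.1,
      mul_le_one₀ (weight_le_one hp _) this.1 this.2⟩

lemma Params.continuous_F (n : ℕ) (b : ℕ → Fin N → Bool) : Continuous (θ.F n b) := by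
  induction n generalizing b with
  | zero => exact continuous_const
  | succ n ih => exact (continuous_weight _).mul ((ih _).comp (θ.continuous_step _))

lemma Params.continuous_Q {f : (Fin N → ℝ) → ℝ} (hf : Continuous f) : Continuous (θ.Q f) :=
  continuous_finsetSum _ fun b _ => (continuous_weight b).mul (hf.comp (θ.continuous_step b))

/-- Each time step adds 1 to the constant, from the Lipschitz bound of `weight`. With the outcome
prescribed, the step itself does not expand distances because β ≤ 1. -/
lemma Params.lipCube_F (hθ : θ.Admissible) (n : ℕ) (b : ℕ → Fin N → Bool) :
    LipCube (θ.F n b) n := by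
  induction n generalizing b with
  | zero => intro p _ q _; simp [Params.F]
  | succ n ih =>
    intro p hp q hq
    set g := θ.F n fun k => b (k + 1)
    have e : θ.F (n + 1) b p - θ.F (n + 1) b q
        = (weight p (b 0) - weight q (b 0)) * g (θ.step p (b 0))
          + weight q (b 0) * (g (θ.step p (b 0)) - g (θ.step q (b 0))) := by
      simp only [Params.F, g]; ring
    have hg := θ.F_mem hθ n (fun k => b (k + 1)) (θ.step_mem_cube hθ hp (b 0))
    have hs : dist1 (θ.step p (b 0)) (θ.step q (b 0)) ≤ dist1 p q := by
      refine (θ.dist1_step_le hθ p q _ _).trans (Finset.sum_le_sum fun j _ => ?_)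
      rw [sub_self, abs_zero, mul_zero, zero_add]
      exact mul_le_of_le_one_left (abs_nonneg _) (hθ.β_le_one j)
    have h1 := abs_weight_sub_le hp hq (b 0)
    have h2 := ih (fun k => b (k + 1)) _ (θ.step_mem_cube hθ hp (b 0)) _ (θ.step_mem_cube hθ hq (b 0))
    rw [e]
    refine (abs_add_le _ _).trans ?_
    rw [abs_mul, abs_mul, abs_of_nonneg (weight_nonneg hq _), abs_of_nonneg hg.1]
    have h3 := mul_le_of_le_one_right (abs_nonneg (weight p (b 0) - weight q (b 0))) hg.2
    have h4 := mul_le_of_le_one_left (abs_nonneg (g (θ.step p (b 0)) - g (θ.step q (b 0))))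
      (weight_le_one hq (b 0))
    have h5 := mul_le_mul_of_nonneg_left hs (Nat.cast_nonneg (α := ℝ) n)
    push_cast
    linarith

end InteractiveGAB

/-! ### Solutions: dependence on past outcomes, conditioning and cylinder probabilities. -/

namespace InteractiveGAB

variable {N : ℕ} {θ : Params N}

lemma Params.step_eq (θ : Params N) (p : Fin N → ℝ) (y : Fin N → Bool) (i : Fin N) :
    θ.step p y i = θ.step 0 y i + θ.β i * p i := by
  simp [Params.step]

/-- The success probabilities as a function of the past outcomes, the most recent one first. -/
noncomputable def Params.past (θ : Params N) (z : ℕ → Fin N → Bool) : Fin N → ℝ :=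
  fun i => ∑' k, θ.β i ^ k * θ.step 0 (z k) i

lemma Params.hasSum_past (hθ : θ.Admissible) (hβ : ∀ i, θ.β i < 1) (z : ℕ → Fin N → Bool)
    (i : Fin N) : HasSum (fun k => θ.β i ^ k * θ.step 0 (z k) i) (θ.past z i) := by
  refine Summable.hasSum ?_
  have hb := (hθ i).2.2.2.1
  have h := fun k => θ.step_mem_cube hθ zero_mem_cube (z k) i
  refine Summable.of_nonneg_of_le (fun k => mul_nonneg (pow_nonneg hb k) (h k).1) (fun k => ?_)
    (summable_geometric_of_lt_one hb (hβ i))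
  exact mul_le_of_le_one_right (pow_nonneg hb k) (h k).2

lemma Params.measurable_past {Ω : Type*} {m : MeasurableSpace Ω} (hθ : θ.Admissible)
    (hβ : ∀ i, θ.β i < 1) {z : ℕ → Ω → Fin N → Bool} (hz : ∀ k, Measurable (z k)) :
    Measurable fun ω => θ.past fun k => z k ω := by
  refine measurable_pi_lambda _ fun i => ?_
  refine measurable_of_tendsto_metrizable (f := fun n ω =>
    ∑ k ∈ Finset.range n, θ.β i ^ k * θ.step 0 (z k ω) i) (fun n => ?_) ?_
  · refine Finset.measurable_sum _ fun k _ => Measurable.const_mul ?_ _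
    exact (measurable_pi_apply i).comp
      ((measurable_of_finite fun b => θ.step 0 b).comp (hz k))
  · rw [tendsto_pi_nhds]
    exact fun ω => (θ.hasSum_past hθ hβ (fun k => z k ω) i).tendsto_sum_nat

/-- Unrolling the recursion n times leaves the remainder β ^ n * x n, which vanishes since the x n
stay in the cube. This makes p_t, up to a null set, measurable with respect to the past outcomes. -/
lemma Params.eq_past (hθ : θ.Admissible) (hβ : ∀ i, θ.β i < 1) {x : ℕ → Fin N → ℝ}
    {z : ℕ → Fin N → Bool} (hx : ∀ k, x k ∈ cube N) (h : ∀ k, x k = θ.step (x (k + 1)) (z k)) :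
    x 0 = θ.past z := by
  ext i
  have hb := (hθ i).2.2.2.1
  have hp : ∀ n, ∑ k ∈ Finset.range n, θ.β i ^ k * θ.step 0 (z k) i
      = x 0 i - θ.β i ^ n * x n i := by
    intro n
    induction n with
    | zero => simp
    | succ n ih =>
      have := congrFun (h n) i
      rw [θ.step_eq] at this
      rw [Finset.sum_range_succ, ih, pow_succ]
      linear_combination -θ.β i ^ n * this
  have h0 : Tendsto (fun n => θ.β i ^ n * x n i) atTop (𝓝 0) := by
    refine squeeze_zero (fun n => mul_nonneg (pow_nonneg hb n) (hx n i).1)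
      (fun n => mul_le_of_le_one_right (pow_nonneg hb n) (hx n i).2)
      (tendsto_pow_atTop_nhds_zero_of_lt_one hb (hβ i))
  have h1 : Tendsto (fun n => x 0 i - θ.β i ^ n * x n i) atTop (𝓝 (x 0 i)) := by
    simpa using h0.const_sub (x 0 i)
  have h2 := (θ.hasSum_past hθ hβ z i).tendsto_sum_nat
  simp only [hp] at h2
  exact tendsto_nhds_unique h1 h2

lemma measurable_info {Ω : Type*} {y : ℤ → Ω → Fin N → Bool} {t s : ℤ} (h : s ≤ t) : Measurable[info y t] (y s) :=
  Measurable.mono (comap_measurable _)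
    (le_iSup₂_of_le (f := fun τ (_ : τ ≤ t) => MeasurableSpace.comap (y τ) inferInstance) s h le_rfl)
    le_rfl

lemma info_mono {Ω : Type*} {y : ℤ → Ω → Fin N → Bool} {t s : ℤ} (h : s ≤ t) : info y s ≤ info y t :=
  iSup₂_le fun τ hτ => le_iSup₂_of_le
    (f := fun τ (_ : τ ≤ t) => MeasurableSpace.comap (y τ) inferInstance) τ (hτ.trans h) le_rfl

section Solution

variable {Ω : Type*} [mΩ : MeasurableSpace Ω] {μ : Measure Ω}
  {p : ℤ → Ω → Fin N → ℝ} {y : ℤ → Ω → Fin N → Bool}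

lemma info_le (hy : ∀ t, Measurable (y t)) (t : ℤ) : info y t ≤ mΩ :=
  iSup₂_le fun τ _ => (hy τ).comap_le

lemma ae_eq_past_of (hθ : θ.Admissible) (hβ : ∀ i, θ.β i < 1)
    (hp : ∀ t, ∀ᵐ ω ∂μ, p t ω ∈ cube N)
    (hr : ∀ t, ∀ᵐ ω ∂μ, p t ω = θ.step (p (t - 1) ω) (y (t - 1) ω)) :
    ∀ᵐ ω ∂μ, ∀ t : ℤ, p t ω = θ.past fun k => y (t - 1 - k) ω := by
  have h1 : ∀ᵐ ω ∂μ, ∀ t, p t ω ∈ cube N := ae_all_iff.2 hp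
  have h2 := ae_all_iff.2 hr
  filter_upwards [h1, h2] with ω h1 h2 t
  have := θ.eq_past hθ hβ (x := fun k : ℕ => p (t - k) ω) (z := fun k => y (t - 1 - k) ω)
    (fun k => h1 _) fun k => by
      rw [h2 (t - k)]
      push_cast
      rw [sub_right_comm, sub_sub, add_comm 1 (k : ℤ)]
  simpa using this

namespace IsSolution

lemma mem_cube (h : IsSolution θ μ p y) (t : ℤ) : ∀ᵐ ω ∂μ, p t ω ∈ cube N := h.mem_Icc t

lemma ae_eq_past (h : IsSolution θ μ p y) (hθ : θ.Admissible) (hβ : ∀ i, θ.β i < 1) :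
    ∀ᵐ ω ∂μ, ∀ t : ℤ, p t ω = θ.past fun k => y (t - 1 - k) ω :=
  ae_eq_past_of hθ hβ h.mem_cube h.recursion

lemma aestronglyMeasurable_comp {E : Type*} [TopologicalSpace E] (h : IsSolution θ μ p y)
    (hθ : θ.Admissible) (hβ : ∀ i, θ.β i < 1) {w : (Fin N → ℝ) → E} (hw : StronglyMeasurable w)
    (t : ℤ) : AEStronglyMeasurable[info y (t - 1)] (fun ω => w (p t ω)) μ := by
  refine ⟨fun ω => w (θ.past fun k => y (t - 1 - k) ω), ?_, ?_⟩
  · exact hw.comp_measurable (θ.measurable_past hθ hβ fun k => measurable_info (by omega))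
  · filter_upwards [h.ae_eq_past hθ hβ] with ω hω
    rw [hω t]

/-- The conditional law stated as an equality of measures on the past σ-algebra. In this form it
applies to arbitrary vector-valued integrands, with no integrability condition. -/
lemma trim_restrict_eq [IsProbabilityMeasure μ] (h : IsSolution θ μ p y) (t : ℤ)
    (b : Fin N → Bool) :
    (μ.restrict {ω | y t ω = b}).trim (info_le h.measurable_y (t - 1))
      = (μ.withDensity fun ω => ENNReal.ofReal (weight (p t ω) b)).trim
          (info_le h.measurable_y (t - 1)) := by
  have hle := info_le h.measurable_y (t - 1)
  have hb : MeasurableSet {ω | y t ω = b} := h.measurable_y t (measurableSet_singleton b)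
  have hw : Measurable fun ω => weight (p t ω) b :=
    (continuous_weight b).measurable.comp (h.measurable_p t)
  have hi : Integrable (fun ω => weight (p t ω) b) μ := by
    refine Integrable.of_bound hw.aestronglyMeasurable 1 ?_
    filter_upwards [h.mem_cube t] with ω hω
    rw [Real.norm_eq_abs, abs_of_nonneg (weight_nonneg hω b)]
    exact weight_le_one hω b
  refine @Measure.ext _ (info y (t - 1)) _ _ fun A hA => ?_
  rw [trim_measurableSet_eq hle hA, trim_measurableSet_eq hle hA,
    Measure.restrict_apply (hle _ hA), withDensity_apply _ (hle _ hA)]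
  have e1 := setIntegral_condExp hle (f := Set.indicator {ω | y t ω = b} fun _ => (1 : ℝ)) (μ := μ)
    ((integrable_const 1).indicator hb) hA
  have e2 : ∫ ω in A, (μ[Set.indicator {ω | y t ω = b} (fun _ => (1 : ℝ)) | info y (t - 1)]) ω ∂μ
      = ∫ ω in A, weight (p t ω) b ∂μ := integral_congr_ae (ae_restrict_of_ae (h.cond_law t b))
  rw [e2, integral_indicator_const _ hb, smul_eq_mul, mul_one] at e1
  rw [← ofReal_integral_eq_lintegral_ofReal hi.integrableOn, e1, measureReal_def,
    ENNReal.ofReal_toReal (measure_ne_top _ _), Measure.restrict_apply hb, Set.inter_comm]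
  exact ae_restrict_of_ae ((h.mem_cube t).mono fun ω hω => weight_nonneg hω b)

lemma setIntegral_eq {E : Type*} [NormedAddCommGroup E] [NormedSpace ℝ E]
    [IsProbabilityMeasure μ] (h : IsSolution θ μ p y) (t : ℤ) (b : Fin N → Bool) {f : Ω → E}
    (hf : AEStronglyMeasurable[info y (t - 1)] f μ) :
    ∫ ω in {ω | y t ω = b}, f ω ∂μ = ∫ ω, weight (p t ω) b • f ω ∂μ := by
  have hle := info_le h.measurable_y (t - 1)
  have hw : Measurable fun ω => weight (p t ω) b :=
    (continuous_weight b).measurable.comp (h.measurable_p t)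
  obtain ⟨g, hg, hfg⟩ := hf
  have e1 : ∫ ω in {ω | y t ω = b}, f ω ∂μ = ∫ ω in {ω | y t ω = b}, g ω ∂μ :=
    integral_congr_ae (ae_restrict_of_ae hfg)
  have e2 : ∫ ω, weight (p t ω) b • f ω ∂μ
      = ∫ ω, (ENNReal.ofReal (weight (p t ω) b)).toReal • g ω ∂μ := by
    refine integral_congr_ae ?_
    filter_upwards [hfg, h.mem_cube t] with ω h1 h2
    rw [h1, ENNReal.toReal_ofReal (weight_nonneg h2 b)]
  rw [e1, e2, ← integral_withDensity_eq_integral_toReal_smul hw.ennreal_ofReal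
    (ae_of_all _ fun _ => ENNReal.ofReal_lt_top), integral_trim hle hg, integral_trim hle hg,
    h.trim_restrict_eq t b]

lemma setIntegral_comp_eq {E : Type*} [NormedAddCommGroup E] [NormedSpace ℝ E]
    [IsProbabilityMeasure μ] (h : IsSolution θ μ p y) (hθ : θ.Admissible) (hβ : ∀ i, θ.β i < 1)
    (t : ℤ) (b : Fin N → Bool) {w : (Fin N → ℝ) → E} (hw : StronglyMeasurable w)
    {A : Set Ω} (hA : MeasurableSet[info y (t - 1)] A) :
    ∫ ω in A ∩ {ω | y t ω = b}, w (p t ω) ∂μ = ∫ ω in A, weight (p t ω) b • w (p t ω) ∂μ := by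
  have hA' := info_le h.measurable_y (t - 1) _ hA
  have := h.setIntegral_eq t b (f := A.indicator fun ω => w (p t ω))
    (by
      obtain ⟨g, hg, hfg⟩ := h.aestronglyMeasurable_comp hθ hβ hw t
      exact ⟨A.indicator g, hg.indicator hA, hfg.indicator⟩)
  rw [setIntegral_indicator hA', Set.inter_comm] at this
  rw [this, ← integral_indicator hA']
  refine integral_congr_ae (ae_of_all _ fun ω => ?_)
  by_cases hω : ω ∈ A <;> simp [hω]

lemma integral_comp_eq {E : Type*} [NormedAddCommGroup E] [NormedSpace ℝ E]
    [IsProbabilityMeasure μ] (h : IsSolution θ μ p y) (hθ : θ.Admissible) (hβ : ∀ i, θ.β i < 1)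
    (t : ℤ) {f : (Fin N → ℝ) → (Fin N → Bool) → E} (hf : ∀ b, StronglyMeasurable fun x => f x b)
    (hi : ∀ b, Integrable (fun ω => f (p t ω) b) μ) :
    ∫ ω, f (p t ω) (y t ω) ∂μ = ∫ ω, ∑ b, weight (p t ω) b • f (p t ω) b ∂μ := by
  have hb : ∀ b, MeasurableSet {ω | y t ω = b} := fun b =>
    h.measurable_y t (measurableSet_singleton b)
  have e : (fun ω => f (p t ω) (y t ω))
      = fun ω => ∑ b, Set.indicator {ω | y t ω = b} (fun ω => f (p t ω) b) ω := by
    ext ω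
    rw [Finset.sum_eq_single (y t ω)]
    · simp
    · intro b _ hb; simp [hb.symm]
    · simp
  rw [e, integral_finsetSum _ fun b _ => (hi b).indicator (hb b), integral_finsetSum]
  · refine Finset.sum_congr rfl fun b _ => ?_
    rw [integral_indicator (hb b)]
    simpa using h.setIntegral_comp_eq hθ hβ t b (hf b) (A := Set.univ) MeasurableSet.univ
  · intro b _
    refine (hi b).bdd_smul 1 ((continuous_weight b).measurable.comp
      (h.measurable_p t)).aestronglyMeasurable ?_
    filter_upwards [h.mem_cube t] with ω hω
    rw [Real.norm_eq_abs, abs_of_nonneg (weight_nonneg hω b)]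
    exact weight_le_one hω b

lemma integrable_comp [IsProbabilityMeasure μ] (h : IsSolution θ μ p y) (t : ℤ)
    {E : Type*} [NormedAddCommGroup E] {w : (Fin N → ℝ) → E} (hw : Continuous w) :
    Integrable (fun ω => w (p t ω)) μ := by
  have hc : IsCompact (cube N) := by
    have : cube N = Set.univ.pi fun _ => Set.Icc (0 : ℝ) 1 := by
      ext; simp only [cube, Set.mem_ofPred_eq, Set.mem_univ_pi]
    rw [this]
    exact isCompact_univ_pi fun _ => isCompact_Icc
  obtain ⟨K, hK⟩ := hc.exists_bound_of_continuousOn hw.continuousOn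
  refine Integrable.of_bound (C := K)
    (hw.stronglyMeasurable.comp_measurable (h.measurable_p t)).aestronglyMeasurable ?_
  filter_upwards [h.mem_cube t] with ω hω using hK _ hω

/-- Cylinder probabilities, jointly with an event of the past. -/
lemma measureReal_inter_cylinder [IsProbabilityMeasure μ] (h : IsSolution θ μ p y)
    (hθ : θ.Admissible) (hβ : ∀ i, θ.β i < 1) (n : ℕ) (b : ℕ → Fin N → Bool) (t : ℤ) {A : Set Ω}
    (hA : MeasurableSet[info y (t - 1)] A) :
    μ.real (A ∩ {ω | ∀ k < n, y (t + k) ω = b k}) = ∫ ω in A, θ.F n b (p t ω) ∂μ := by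
  induction n generalizing b t A with
  | zero => simp [Params.F]
  | succ n ih =>
    have hb : MeasurableSet[info y t] {ω | y t ω = b 0} :=
      measurable_info le_rfl (measurableSet_singleton _)
    -- The first outcome is absorbed into the event of the past; this is why the statement carries a
    -- general A.
    have e : A ∩ {ω | ∀ k < n + 1, y (t + k) ω = b k}
        = (A ∩ {ω | y t ω = b 0}) ∩ {ω | ∀ k < n, y (t + 1 + k) ω = b (k + 1)} := by
      ext ω
      simp only [Set.mem_inter_iff, Set.mem_ofPred_eq, and_assoc, Nat.forall_lt_succ_left']
      simp [add_assoc, add_comm (1 : ℤ)]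
    have hA' : MeasurableSet[info y (t + 1 - 1)] (A ∩ {ω | y t ω = b 0}) := by
      rw [add_sub_cancel_right]
      exact (info_mono (by omega) _ hA).inter hb
    rw [e, ih _ (t + 1) hA']
    have hr : ∀ᵐ ω ∂μ.restrict (A ∩ {ω | y t ω = b 0}),
        θ.F n (fun k => b (k + 1)) (p (t + 1) ω)
          = θ.F n (fun k => b (k + 1)) (θ.step (p t ω) (b 0)) := by
      have h1 := ae_restrict_mem (μ := μ) (info_le h.measurable_y _ _ hA')
      filter_upwards [h1, ae_restrict_of_ae (h.recursion (t + 1))] with ω h1 h2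
      have : y t ω = b 0 := h1.2
      rw [h2, add_sub_cancel_right, this]
    rw [integral_congr_ae hr]
    exact h.setIntegral_comp_eq hθ hβ t (b 0)
      (((θ.continuous_F n _).comp (θ.continuous_step (b 0))).stronglyMeasurable) hA

lemma integral_Q [IsProbabilityMeasure μ] (h : IsSolution θ μ p y)
    (hθ : θ.Admissible) (hβ : ∀ i, θ.β i < 1) {f : (Fin N → ℝ) → ℝ} (hf : Continuous f) (t : ℤ) :
    ∫ ω, f (p t ω) ∂μ = ∫ ω, θ.Q f (p (t - 1) ω) ∂μ := by
  have hc := fun b => hf.comp (θ.continuous_step b)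
  have := h.integral_comp_eq hθ hβ (t - 1) (f := fun x b => f (θ.step x b))
    (fun b => (hc b).stronglyMeasurable) fun b => h.integrable_comp _ (hc b)
  simp only [smul_eq_mul] at this
  simp only [Params.Q]
  rw [← this]
  refine integral_congr_ae ?_
  filter_upwards [h.recursion t] with ω hω
  rw [hω]

lemma integral_Q_iterate [IsProbabilityMeasure μ] (h : IsSolution θ μ p y)
    (hθ : θ.Admissible) (hβ : ∀ i, θ.β i < 1) {f : (Fin N → ℝ) → ℝ} (hf : Continuous f) (t : ℤ)
    (m : ℕ) : ∫ ω, f (p t ω) ∂μ = ∫ ω, θ.Q^[m] f (p (t - m) ω) ∂μ := by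
  induction m generalizing f t with
  | zero => simp
  | succ m ih =>
    rw [h.integral_Q hθ hβ hf, ih (θ.continuous_Q hf), Function.iterate_succ_apply]
    push_cast
    rw [sub_sub, add_comm 1 (m : ℤ)]

/-- After m steps back the integrand varies by at most ρ ^ m * L * N on the cube, whose ℓ¹ diameter
is at most N. The reference value at 0 does not depend on the solution, and stationarity plays no
role. -/
lemma abs_integral_sub_le [IsProbabilityMeasure μ] (h : IsSolution θ μ p y)
    (hθ : θ.Admissible) (hβ : ∀ i, θ.β i < 1) {ρ : ℝ} (hρ0 : 0 ≤ ρ) (hρ : θ.Contracting ρ)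
    {f : (Fin N → ℝ) → ℝ} (hf : Continuous f) {L : ℝ} (hL : 0 ≤ L) (hfL : LipCube f L) (t : ℤ)
    (m : ℕ) : |∫ ω, f (p t ω) ∂μ - θ.Q^[m] f 0| ≤ ρ ^ m * L * N := by
  have hc : Continuous (θ.Q^[m] f) := by
    induction m with
    | zero => simpa using hf
    | succ m ih => rw [Function.iterate_succ_apply']; exact θ.continuous_Q ih
  have hi := h.integrable_comp (t - m) hc
  rw [h.integral_Q_iterate hθ hβ hf t m]
  have : θ.Q^[m] f 0 = ∫ _, θ.Q^[m] f 0 ∂μ := by simp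
  rw [this, ← integral_sub hi (integrable_const _), ← Real.norm_eq_abs]
  refine (norm_integral_le_of_norm_le_const (μ := μ) (C := ρ ^ m * L * N) ?_).trans
    (le_of_eq (by rw [probReal_univ, mul_one]))
  filter_upwards [h.mem_cube (t - m)] with ω hω
  refine (θ.lipCube_Q_iterate hθ hρ0 hρ hL hfL m _ hω _ zero_mem_cube).trans ?_
  exact mul_le_mul_of_nonneg_left (dist1_le_card hω zero_mem_cube) (by positivity)

end IsSolution

end Solution

end InteractiveGAB

/-! ### Uniqueness in law and transfer to path space. -/

namespace InteractiveGAB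

set_option linter.unusedSectionVars false

variable {N : ℕ} {θ : Params N}

lemma Params.Contracting.β_lt_one (hθ : θ.Admissible) {ρ : ℝ} (hρ1 : ρ < 1)
    (hρ : θ.Contracting ρ) (i : Fin N) : θ.β i < 1 := by
  have h1 := hρ i
  have h2 : 0 ≤ (1 / (N : ℝ)) * ∑ i, θ.γ i :=
    mul_nonneg (by positivity) (Finset.sum_nonneg fun i _ => (hθ i).2.2.1)
  have h3 := (hθ i).2.1
  linarith

section Uniqueness

variable {Ω Ω' : Type*} [MeasurableSpace Ω] [MeasurableSpace Ω'] {μ : Measure Ω} {μ' : Measure Ω'}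
  [IsProbabilityMeasure μ] [IsProbabilityMeasure μ']
  {p : ℤ → Ω → Fin N → ℝ} {y : ℤ → Ω → Fin N → Bool}
  {p' : ℤ → Ω' → Fin N → ℝ} {y' : ℤ → Ω' → Fin N → Bool}

lemma IsSolution.tendsto_iterate (h : IsSolution θ μ p y) (hθ : θ.Admissible)
    (hβ : ∀ i, θ.β i < 1) {ρ : ℝ} (hρ0 : 0 ≤ ρ) (hρ1 : ρ < 1) (hρ : θ.Contracting ρ)
    {f : (Fin N → ℝ) → ℝ} (hf : Continuous f) {L : ℝ} (hL : 0 ≤ L) (hfL : LipCube f L) (t : ℤ) :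
    Tendsto (fun m => θ.Q^[m] f 0) atTop (𝓝 (∫ ω, f (p t ω) ∂μ)) := by
  have l : Tendsto (fun m => ρ ^ m * L * N) atTop (𝓝 0) := by
    simpa using ((tendsto_pow_atTop_nhds_zero_of_lt_one hρ0 hρ1).mul_const L).mul_const (N : ℝ)
  refine tendsto_iff_norm_sub_tendsto_zero.2 (squeeze_zero (fun _ => norm_nonneg _) (fun m => ?_) l)
  rw [Real.norm_eq_abs, abs_sub_comm]
  exact h.abs_integral_sub_le hθ hβ hρ0 hρ hf hL hfL t m

lemma IsSolution.measureReal_cylinder_eq (h : IsSolution θ μ p y) (h' : IsSolution θ μ' p' y')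
    (hθ : θ.Admissible) {ρ : ℝ} (hρ0 : 0 ≤ ρ) (hρ1 : ρ < 1) (hρ : θ.Contracting ρ) (t : ℤ) (n : ℕ)
    (b : ℕ → Fin N → Bool) :
    μ.real {ω | ∀ k < n, y (t + k) ω = b k} = μ'.real {ω | ∀ k < n, y' (t + k) ω = b k} := by
  have hβ := hρ.β_lt_one hθ hρ1
  have e := h.measureReal_inter_cylinder hθ hβ n b t MeasurableSet.univ
  have e' := h'.measureReal_inter_cylinder hθ hβ n b t MeasurableSet.univ
  rw [Set.univ_inter, Measure.restrict_univ] at e e'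
  rw [e, e']
  exact tendsto_nhds_unique
    (h.tendsto_iterate hθ hβ hρ0 hρ1 hρ (θ.continuous_F n b) n.cast_nonneg (θ.lipCube_F hθ n b) t)
    (h'.tendsto_iterate hθ hβ hρ0 hρ1 hρ (θ.continuous_F n b) n.cast_nonneg (θ.lipCube_F hθ n b) t)

/-- All solutions have the same outcome process in law. -/
lemma IsSolution.map_outcomes_eq (h : IsSolution θ μ p y) (h' : IsSolution θ μ' p' y')
    (hθ : θ.Admissible) {ρ : ℝ} (hρ0 : 0 ≤ ρ) (hρ1 : ρ < 1) (hρ : θ.Contracting ρ) :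
    μ.map (fun ω t => y t ω) = μ'.map fun ω t => y' t ω := by
  have hm := measurable_pi_lambda (fun ω t => y t ω) h.measurable_y
  have hm' := measurable_pi_lambda (fun ω t => y' t ω) h'.measurable_y
  have _ := Measure.isProbabilityMeasure_map (μ := μ) hm.aemeasurable
  have _ := Measure.isProbabilityMeasure_map (μ := μ') hm'.aemeasurable
  have key : ∀ n : ℕ, (μ.map fun ω t => y t ω).map (Finset.Icc (-n : ℤ) n).restrict
      = (μ'.map fun ω t => y' t ω).map (Finset.Icc (-n : ℤ) n).restrict := by
    intro n
    -- Outcomes on a finite time window take finitely many values, so point masses, that is cylinder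
    -- probabilities, determine the marginal.
    refine Measure.ext_of_singleton fun a => ?_
    have hr := Finset.measurable_restrict (X := fun _ : ℤ => Fin N → Bool) (Finset.Icc (-n : ℤ) n)
    rw [Measure.map_map hr hm, Measure.map_map hr hm',
      Measure.map_apply (hr.comp hm) (measurableSet_singleton a),
      Measure.map_apply (hr.comp hm') (measurableSet_singleton a)]
    -- The window is listed from time -n on. The default value is never read, since only k < 2 * n +
    -- 1 matters.
    let b : ℕ → Fin N → Bool := fun k =>
      if hk : (-n + k : ℤ) ∈ Finset.Icc (-n : ℤ) n then a ⟨_, hk⟩ else fun _ => false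
    have e : ∀ z : ℤ → Fin N → Bool, (Finset.Icc (-n : ℤ) n).restrict z = a ↔
        ∀ k < 2 * n + 1, z (-n + k) = b k := by
      intro z
      constructor
      · intro hz k hk
        have hk' : (-n + k : ℤ) ∈ Finset.Icc (-n : ℤ) n := by
          rw [Finset.mem_Icc]; omega
        simp only [b, dif_pos hk', ← hz, Finset.restrict]
      · intro hz
        ext1 ⟨t, ht⟩
        have ht' := Finset.mem_Icc.1 ht
        obtain ⟨k, hk⟩ : ∃ k : ℕ, t = -n + k := ⟨(t + n).toNat, by omega⟩
        subst hk
        have := hz k (by omega)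
        simp only [b, dif_pos ht] at this
        exact this
    have s : ((Finset.Icc (-n : ℤ) n).restrict ∘ fun ω t => y t ω) ⁻¹' {a}
        = {ω | ∀ k < 2 * n + 1, y (-n + k) ω = b k} := by
      ext ω; exact e fun t => y t ω
    have s' : ((Finset.Icc (-n : ℤ) n).restrict ∘ fun ω t => y' t ω) ⁻¹' {a}
        = {ω | ∀ k < 2 * n + 1, y' (-n + k) ω = b k} := by
      ext ω; exact e fun t => y' t ω
    rw [s, s', ← measureReal_eq_measureReal_iff]
    exact h.measureReal_cylinder_eq h' hθ hρ0 hρ1 hρ (-n) (2 * n + 1) b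
  refine IsProjectiveLimit.unique
    (P := fun I : Finset ℤ => (μ'.map fun ω t => y' t ω).map I.restrict) (fun I => ?_) fun I => rfl
  -- Every finite set of times lies in a symmetric window, so its marginal is an image of one
  -- already identified.
  have hI : I ⊆ Finset.Icc (-(I.sup Int.natAbs : ℕ) : ℤ) (I.sup Int.natAbs : ℕ) := by
    intro t ht
    have := Finset.le_sup (f := Int.natAbs) ht
    rw [Finset.mem_Icc]; omega
  have := congrArg (Measure.map (Finset.restrict₂ (π := fun _ : ℤ => Fin N → Bool) hI))
    (key (I.sup Int.natAbs))
  rwa [Measure.map_map (Finset.measurable_restrict₂ hI) (Finset.measurable_restrict _),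
    Measure.map_map (Finset.measurable_restrict₂ hI) (Finset.measurable_restrict _)] at this

lemma IsSolution.map_trajectory_eq_map_past (h : IsSolution θ μ p y)
    (hθ : θ.Admissible) (hβ : ∀ i, θ.β i < 1) :
    μ.map (trajectory p y) = (μ.map fun ω t => y t ω).map
      fun z t => (θ.past fun k => z (t - 1 - k), z t) := by
  have hm := measurable_pi_lambda (fun ω t => y t ω) h.measurable_y
  rw [Measure.map_map _ hm]
  · refine Measure.map_congr ?_
    filter_upwards [h.ae_eq_past hθ hβ] with ω hω
    ext1 t
    simp only [trajectory, hω t, Function.comp]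
  · refine measurable_pi_lambda _ fun t => Measurable.prodMk ?_ (measurable_pi_apply t)
    exact θ.measurable_past hθ hβ fun k => measurable_pi_apply _

/-- All solutions have the same law. -/
theorem IsSolution.map_trajectory_eq (h : IsSolution θ μ p y) (h' : IsSolution θ μ' p' y')
    (hθ : θ.Admissible) {ρ : ℝ} (hρ0 : 0 ≤ ρ) (hρ1 : ρ < 1) (hρ : θ.Contracting ρ) :
    μ.map (trajectory p y) = μ'.map (trajectory p' y') := by
  have hβ := hρ.β_lt_one hθ hρ1
  rw [h.map_trajectory_eq_map_past hθ hβ, h'.map_trajectory_eq_map_past hθ hβ,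
    h.map_outcomes_eq h' hθ hρ0 hρ1 hρ]

end Uniqueness

section Transfer

variable {Ω : Type*} [MeasurableSpace Ω] {μ : Measure Ω} [IsProbabilityMeasure μ]
  {p : ℤ → Ω → Fin N → ℝ} {y : ℤ → Ω → Fin N → Bool}

/-- The characterisation of conditional expectation by integrals over past events. The required
measurability of `weight (p t ω) b` comes from the series `Params.past`, which is where β < 1
enters. -/
lemma isSolution_of_forall_measureReal_inter (hθ : θ.Admissible) (hβ : ∀ i, θ.β i < 1)
    (hp : ∀ t, Measurable (p t)) (hy : ∀ t, Measurable (y t))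
    (hc : ∀ t, ∀ᵐ ω ∂μ, p t ω ∈ cube N)
    (hr : ∀ t, ∀ᵐ ω ∂μ, p t ω = θ.step (p (t - 1) ω) (y (t - 1) ω))
    (hA : ∀ t b A, MeasurableSet[info y (t - 1)] A →
      μ.real (A ∩ {ω | y t ω = b}) = ∫ ω in A, weight (p t ω) b ∂μ) :
    IsSolution θ μ p y where
  measurable_p := hp
  measurable_y := hy
  mem_Icc := hc
  recursion := hr
  cond_law t b := by
    have hle := info_le hy (t - 1)
    have hb : MeasurableSet {ω | y t ω = b} := hy t (measurableSet_singleton b)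
    refine (ae_eq_condExp_of_forall_setIntegral_eq (g := fun ω => weight (p t ω) b) hle
      ((integrable_const 1).indicator hb) (fun A _ _ => ?_) (fun A hA' _ => ?_) ?_).symm
    · have hw : Measurable fun ω => weight (p t ω) b := (continuous_weight b).measurable.comp (hp t)
      refine (Integrable.of_bound hw.aestronglyMeasurable 1 ?_).integrableOn
      filter_upwards [hc t] with ω hω
      rw [Real.norm_eq_abs, abs_of_nonneg (weight_nonneg hω b)]
      exact weight_le_one hω b
    · rw [← hA t b A hA', setIntegral_indicator hb, setIntegral_const, smul_eq_mul, mul_one]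
    · refine ⟨fun ω => weight (θ.past fun k => y (t - 1 - k) ω) b, ?_, ?_⟩
      · exact (continuous_weight b).stronglyMeasurable.comp_measurable
          (θ.measurable_past hθ hβ fun k => measurable_info (by omega))
      · filter_upwards [ae_eq_past_of hθ hβ hc hr] with ω hω
        rw [hω t]

lemma IsSolution.measurable_trajectory (h : IsSolution θ μ p y) : Measurable (trajectory p y) :=
  measurable_pi_lambda _ fun t => (h.measurable_p t).prodMk (h.measurable_y t)

/-- The coordinate process is a solution under the law of a solution. -/
theorem IsSolution.isSolution_map (h : IsSolution θ μ p y) (hθ : θ.Admissible)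
    (hβ : ∀ i, θ.β i < 1) :
    IsSolution θ (μ.map (trajectory p y)) (fun t x => (x t).1) (fun t x => (x t).2) := by
  have hT := h.measurable_trajectory
  have _ := Measure.isProbabilityMeasure_map (μ := μ) hT.aemeasurable
  have hp : ∀ t : ℤ, Measurable fun x : Path N => (x t).1 := fun t => by fun_prop
  have hy : ∀ t : ℤ, Measurable fun x : Path N => (x t).2 := fun t => by fun_prop
  refine isSolution_of_forall_measureReal_inter hθ hβ hp hy (fun t => ?_) (fun t => ?_)
    fun t b A hA => ?_
  · exact (ae_map_iff hT.aemeasurable (measurableSet_cube.preimage (hp t))).2 (h.mem_cube t)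
  · refine (ae_map_iff hT.aemeasurable (measurableSet_eq_fun (hp t) ?_)).2 (h.recursion t)
    exact Params.measurable_step.comp ((hp _).prodMk (hy _))
  · have hA' : MeasurableSet A := info_le hy _ _ hA
    have hTA : MeasurableSet[info y (t - 1)] (trajectory p y ⁻¹' A) := by
      have : Measurable[info y (t - 1), info (fun (t : ℤ) (x : Path N) => (x t).2) (t - 1)]
          (trajectory p y) := by
        rw [measurable_iff_comap_le]
        simp only [MeasurableSpace.comap_iSup, MeasurableSpace.comap_comp]
        exact le_rfl
      exact this hA
    have := h.setIntegral_comp_eq hθ hβ t b (w := fun _ => (1 : ℝ)) stronglyMeasurable_const hTA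
    simp only [setIntegral_const, smul_eq_mul, mul_one] at this
    have hb : MeasurableSet {x : Path N | (x t).2 = b} := hy t (measurableSet_singleton b)
    have hw : Measurable fun x : Path N => weight (x t).1 b :=
      (continuous_weight b).measurable.comp (hp t)
    rw [setIntegral_map hA' hw.aestronglyMeasurable
      hT.aemeasurable, measureReal_def, Measure.map_apply hT (hA'.inter hb)]
    exact this

lemma IsSolution.shift (h : IsSolution θ μ p y) (s : ℤ) :
    IsSolution θ μ (fun t => p (t + s)) (fun t => y (t + s)) where
  measurable_p t := h.measurable_p _
  measurable_y t := h.measurable_y _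
  mem_Icc t := h.mem_Icc _
  recursion t := by simpa only [sub_add_eq_add_sub] using h.recursion (t + s)
  cond_law t b := by
    have e : info (fun t => y (t + s)) (t - 1) = info y (t + s - 1) := by
      refine le_antisymm (iSup₂_le fun τ hτ => ?_) (iSup₂_le fun τ hτ => ?_)
      · exact le_iSup₂_of_le
          (f := fun τ (_ : τ ≤ t + s - 1) => MeasurableSpace.comap (y τ) inferInstance)
          (τ + s) (by omega) le_rfl
      · refine le_iSup₂_of_le
          (f := fun τ (_ : τ ≤ t - 1) => MeasurableSpace.comap (y (τ + s)) inferInstance)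
          (τ - s) (by omega) ?_
        rw [sub_add_cancel]
    rw [e]
    exact h.cond_law (t + s) b

/-- Uniqueness holds among all solutions, and the shift of a solution is a solution; so the law of
any solution is automatically shift invariant. -/
theorem IsSolution.hasUniqueStationarySolution (h : IsSolution θ μ p y) (hθ : θ.Admissible) {ρ : ℝ}
    (hρ0 : 0 ≤ ρ) (hρ1 : ρ < 1) (hρ : θ.Contracting ρ) : HasUniqueStationarySolution θ := by
  have hβ := hρ.β_lt_one hθ hρ1
  have hP := Measure.isProbabilityMeasure_map (μ := μ) h.measurable_trajectory.aemeasurable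
  have hs := h.isSolution_map hθ hβ
  refine ⟨μ.map (trajectory p y), hP, ⟨hs, fun s => ?_⟩, fun Ω' _ μ' _ p' y' h' => ?_⟩
  · exact (hs.shift s).map_trajectory_eq hs hθ hρ0 hρ1 hρ
  · exact h'.toIsSolution.map_trajectory_eq h hθ hρ0 hρ1 hρ

end Transfer

end InteractiveGAB

/-! ### Existence: the minimal solution driven by independent uniforms. -/

namespace InteractiveGAB

variable {N : ℕ} {θ : Params N}

/-- Fubini for the independent pair formed by `u` and (P, membership in A). Carrying the membership
along with P treats the event and the threshold at once. -/
lemma measure_inter_thr {Ω : Type*} {m mΩ : MeasurableSpace Ω} {μ : Measure Ω}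
    [IsProbabilityMeasure μ] (hm : m ≤ mΩ) {u P : Ω → Fin N → ℝ}
    (hu : Measurable u) (hlaw : μ.map u = unif N) (hind : Indep m (MeasurableSpace.comap u inferInstance) μ)
    (hP : Measurable[m] P) (hc : ∀ ω, P ω ∈ cube N) (b : Fin N → Bool) {A : Set Ω}
    (hA : MeasurableSet[m] A) :
    μ (A ∩ {ω | thr (P ω) (u ω) = b}) = ∫⁻ ω in A, ENNReal.ofReal (weight (P ω) b) ∂μ := by
  have hV : Measurable[m] fun ω => (P ω, ω ∈ A) := hP.prodMk ((@measurable_mem Ω A m).2 hA)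
  have hV' : Measurable fun ω => (P ω, ω ∈ A) := hV.mono hm le_rfl
  have hi : IndepFun (fun ω => (P ω, ω ∈ A)) u μ :=
    indep_of_indep_of_le_left hind hV.comap_le
  have hj := (indepFun_iff_map_prod_eq_prod_map_map hV'.aemeasurable hu.aemeasurable).1 hi
  have hS : MeasurableSet {x : ((Fin N → ℝ) × Prop) × (Fin N → ℝ) | x.1.2 ∧ thr x.1.1 x.2 = b} := by
    refine MeasurableSet.inter (measurableSet_setOfPred.2 (by fun_prop)) ?_
    have : Measurable fun x : ((Fin N → ℝ) × Prop) × (Fin N → ℝ) => thr x.1.1 x.2 :=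
      measurable_thr.comp ((by fun_prop : Measurable fun x : ((Fin N → ℝ) × Prop) × (Fin N → ℝ) =>
        (x.1.1, x.2)))
    exact this (measurableSet_singleton b)
  have e : A ∩ {ω | thr (P ω) (u ω) = b} = (fun ω => ((P ω, ω ∈ A), u ω)) ⁻¹'
      {x : ((Fin N → ℝ) × Prop) × (Fin N → ℝ) | x.1.2 ∧ thr x.1.1 x.2 = b} := rfl
  rw [e, ← Measure.map_apply (hV'.prodMk hu) hS, hj, hlaw, Measure.prod_apply hS,
    lintegral_map (measurable_measure_prodMk_left hS) hV', ← lintegral_indicator (hm _ hA)]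
  refine lintegral_congr fun ω => ?_
  by_cases hω : ω ∈ A
  · simp only [Set.indicator_of_mem hω, ← unif_thr (hc ω) b]
    congr 1
    ext; simp [hω]
  · simp [hω]

/-- Uniform variables indexed by time. -/
abbrev Noise (N : ℕ) : Type := ℤ → Fin N → ℝ

/-- The law of independent uniform variables. -/
noncomputable def noiseLaw (N : ℕ) : Measure (Noise N) := Measure.infinitePi fun _ => unif N

instance : IsProbabilityMeasure (noiseLaw N) := by unfold noiseLaw; infer_instance

/-- The success probabilities at time `t` of the model started from `0` at time `t - n`. -/
noncomputable def Params.approx (θ : Params N) : ℕ → ℤ → Noise N → Fin N → ℝ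
  | 0, _, _ => 0
  | n + 1, t, U => θ.step (θ.approx n (t - 1) U) (thr (θ.approx n (t - 1) U) (U (t - 1)))

/-- The success probabilities of the minimal solution driven by given uniform variables. -/
noncomputable def Params.minimal (θ : Params N) (t : ℤ) (U : Noise N) : Fin N → ℝ :=
  fun i => ⨆ n, θ.approx n t U i

lemma Params.approx_mem_cube (hθ : θ.Admissible) (n : ℕ) (t : ℤ) (U : Noise N) :
    θ.approx n t U ∈ cube N := by
  cases n with
  | zero => exact zero_mem_cube
  | succ n =>
    induction n generalizing t with
    | zero => exact θ.step_mem_cube hθ zero_mem_cube _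
    | succ n ih => exact θ.step_mem_cube hθ (ih _) _

lemma val_thr_mono {p q : Fin N → ℝ} (h : p ≤ q) (u : Fin N → ℝ) (i : Fin N) :
    val (thr p u i) ≤ val (thr q u i) := by
  have := h i
  simp only [thr, val, decide_eq_true_eq]
  split_ifs <;> linarith

/-- An earlier start replaces the initial value 0 by something larger, and both the thresholding and
the step are monotone. -/
lemma Params.approx_le_succ (hθ : θ.Admissible) (n : ℕ) (t : ℤ) (U : Noise N) :
    θ.approx n t U ≤ θ.approx (n + 1) t U := by
  induction n generalizing t with
  | zero => exact fun i => (θ.approx_mem_cube hθ 1 t U i).1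
  | succ n ih => exact θ.step_mono hθ (ih _) (val_thr_mono (ih _) _)

lemma Params.tendsto_approx (hθ : θ.Admissible) (t : ℤ) (U : Noise N) :
    Tendsto (fun n => θ.approx n t U) atTop (𝓝 (θ.minimal t U)) := by
  rw [tendsto_pi_nhds]
  refine fun i => tendsto_atTop_ciSup (monotone_nat_of_le_succ fun n => θ.approx_le_succ hθ n t U i)
    ⟨1, ?_⟩
  rintro _ ⟨n, rfl⟩
  exact (θ.approx_mem_cube hθ n t U i).2

lemma Params.approx_le_minimal (hθ : θ.Admissible) (n : ℕ) (t : ℤ) (U : Noise N) :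
    θ.approx n t U ≤ θ.minimal t U := fun i =>
  le_ciSup (f := fun n => θ.approx n t U i)
    ⟨1, by rintro _ ⟨n, rfl⟩; exact (θ.approx_mem_cube hθ n t U i).2⟩ n

lemma Params.minimal_mem_cube (hθ : θ.Admissible) (t : ℤ) (U : Noise N) :
    θ.minimal t U ∈ cube N := fun i =>
  ⟨(θ.approx_mem_cube hθ 0 t U i).1.trans (θ.approx_le_minimal hθ 0 t U i),
    ciSup_le fun n => (θ.approx_mem_cube hθ n t U i).2⟩

/-- Passage to the limit in the recursion. The thresholding is discontinuous in p, but it is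
continuous along increasing sequences because it uses the strict inequality u < p: if u lies below
the supremum, it lies below some approximation. The outcomes are thus eventually constant. -/
lemma Params.minimal_eq (hθ : θ.Admissible) (t : ℤ) (U : Noise N) :
    θ.minimal t U = θ.step (θ.minimal (t - 1) U) (thr (θ.minimal (t - 1) U) (U (t - 1))) := by
  have h1 := (θ.tendsto_approx hθ t U).comp (tendsto_add_atTop_nat 1)
  have h2 := θ.tendsto_approx hθ (t - 1) U
  have h3 : ∀ᶠ n in atTop,
      thr (θ.approx n (t - 1) U) (U (t - 1)) = thr (θ.minimal (t - 1) U) (U (t - 1)) := by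
    have : ∀ i, ∀ᶠ n in atTop,
        thr (θ.approx n (t - 1) U) (U (t - 1)) i = thr (θ.minimal (t - 1) U) (U (t - 1)) i := by
      intro i
      by_cases hi : U (t - 1) i < θ.minimal (t - 1) U i
      · filter_upwards [(tendsto_pi_nhds.1 h2 i).eventually_const_lt hi] with n hn
        simp [thr, hi, hn]
      · refine Eventually.of_forall fun n => ?_
        have hn : ¬ U (t - 1) i < θ.approx n (t - 1) U i := fun h =>
          hi (h.trans_le (θ.approx_le_minimal hθ n (t - 1) U i))
        simp [thr, hi, hn]
    filter_upwards [eventually_all.2 this] with n hn using funext hn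
  have h4 := ((θ.continuous_step (thr (θ.minimal (t - 1) U) (U (t - 1)))).tendsto _).comp h2
  refine tendsto_nhds_unique h1 (h4.congr' ?_)
  filter_upwards [h3] with n hn
  simp only [Function.comp, Params.approx, hn]

/-- The information in the uniform variables strictly before time `t`. -/
abbrev noisePast (N : ℕ) (t : ℤ) : MeasurableSpace (Noise N) :=
  ⨆ s ∈ Set.Iio t, MeasurableSpace.comap (fun U : Noise N => U s) inferInstance

lemma measurable_noisePast {s t : ℤ} (h : s < t) : Measurable[noisePast N t] fun U : Noise N => U s :=
  Measurable.mono (comap_measurable _)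
    (le_iSup₂_of_le (f := fun s (_ : s ∈ Set.Iio t) =>
      MeasurableSpace.comap (fun U : Noise N => U s) inferInstance) s h le_rfl) le_rfl

lemma noisePast_mono {s t : ℤ} (h : s ≤ t) : noisePast N s ≤ noisePast N t :=
  iSup₂_le fun τ hτ => le_iSup₂_of_le (f := fun s (_ : s ∈ Set.Iio t) =>
      MeasurableSpace.comap (fun U : Noise N => U s) inferInstance) τ (hτ.trans_le h) le_rfl

lemma noisePast_le (t : ℤ) : noisePast N t ≤ MeasurableSpace.pi :=
  iSup₂_le fun s _ => (measurable_pi_apply s).comap_le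

lemma Params.measurable_approx (θ : Params N) (n : ℕ) (t : ℤ) :
    Measurable[noisePast N t] (θ.approx n t) := by
  induction n generalizing t with
  | zero => exact measurable_const
  | succ n ih =>
    have h1 : Measurable[noisePast N t] (θ.approx n (t - 1)) :=
      (ih (t - 1)).mono (noisePast_mono (by omega)) le_rfl
    have h2 : Measurable[noisePast N t] fun U => thr (θ.approx n (t - 1) U) (U (t - 1)) :=
      measurable_thr.comp (h1.prodMk (measurable_noisePast (by omega)))
    exact Params.measurable_step.comp (h1.prodMk h2)

lemma Params.measurable_minimal (hθ : θ.Admissible) (t : ℤ) :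
    Measurable[noisePast N t] (θ.minimal t) :=
  @measurable_of_tendsto_metrizable (Noise N) (Fin N → ℝ) (noisePast N t) _ _ _ _ _ _
    (θ.measurable_approx · t)
    (tendsto_pi_nhds.2 fun U => θ.tendsto_approx hθ t U)

/-- Both p_t and the outcomes before t are functions of the uniforms before t, hence independent of
the uniforms at time t that decide y_t. -/
theorem Params.isSolution_minimal (hθ : θ.Admissible) (hβ : ∀ i, θ.β i < 1) :
    IsSolution θ (noiseLaw N) θ.minimal fun t U => thr (θ.minimal t U) (U t) := by
  have hm : ∀ t, Measurable (θ.minimal t) := fun t =>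
    (θ.measurable_minimal hθ t).mono (noisePast_le t) le_rfl
  have hy : ∀ {s t : ℤ}, s < t → Measurable[noisePast N t] fun U => thr (θ.minimal s U) (U s) :=
    fun {s t} h => measurable_thr.comp
      (((θ.measurable_minimal hθ s).mono (noisePast_mono h.le) le_rfl).prodMk
        (measurable_noisePast h))
  refine isSolution_of_forall_measureReal_inter hθ hβ hm
    (fun t => measurable_thr.comp ((hm t).prodMk (measurable_pi_apply t)))
    (fun t => ae_of_all _ fun U => θ.minimal_mem_cube hθ t U)
    (fun t => ae_of_all _ fun U => θ.minimal_eq hθ t U) fun t b A hA => ?_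
  have hinfo : info (fun t U => thr (θ.minimal t U) (U t)) (t - 1) ≤ noisePast N t :=
    iSup₂_le fun τ hτ => (hy (by omega)).comap_le
  have hind : Indep (noisePast N t)
      (MeasurableSpace.comap (fun U : Noise N => U t) inferInstance) (noiseLaw N) := by
    have h1 : iIndepFun (fun (s : ℤ) (U : Noise N) => U s) (noiseLaw N) :=
      iIndepFun_infinitePi (X := fun _ x => x) fun _ => measurable_id
    have h2 := indep_iSup_of_disjoint (fun s => (measurable_pi_apply s).comap_le) h1.iIndep
      (S := Set.Iio t) (T := {t}) (by simp)
    simpa only [iSup_singleton] using h2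
  have hlaw : (noiseLaw N).map (fun U : Noise N => U t) = unif N :=
    Measure.infinitePi_map_eval (fun _ : ℤ => unif N) t
  have := measure_inter_thr (noisePast_le t) (measurable_pi_apply t) hlaw hind
    (θ.measurable_minimal hθ t) (θ.minimal_mem_cube hθ t) b (hinfo _ hA)
  rw [measureReal_def, this, integral_eq_lintegral_of_nonneg_ae]
  · exact ae_of_all _ fun U => weight_nonneg (θ.minimal_mem_cube hθ t U) b
  · exact ((continuous_weight b).measurable.comp (hm t)).aestronglyMeasurable

theorem Params.hasUniqueStationarySolution (hθ : θ.Admissible) {ρ : ℝ} (hρ0 : 0 ≤ ρ) (hρ1 : ρ < 1)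
    (hρ : θ.Contracting ρ) : HasUniqueStationarySolution θ :=
  (θ.isSolution_minimal hθ (hρ.β_lt_one hθ hρ1)).hasUniqueStationarySolution hθ hρ0 hρ1 hρ

end InteractiveGAB

/-! ### Exponentials on the left half-plane and Poisson approximation. -/

namespace InteractiveGAB

variable {N : ℕ} {θ : Params N}

lemma norm_exp_le_one {x : ℂ} (hx : x.re ≤ 0) : ‖Complex.exp x‖ ≤ 1 := by
  rw [Complex.norm_exp]; exact Real.exp_le_one_iff.2 hx

lemma norm_exp_sub_exp_le {x y : ℂ} (hx : x.re ≤ 0) (hy : y.re ≤ 0) :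
    ‖Complex.exp x - Complex.exp y‖ ≤ ‖x - y‖ := by
  have := (convex_halfSpace_re_le 0).norm_image_sub_le_of_norm_deriv_le (f := Complex.exp) (C := 1)
    (fun z _ => Complex.differentiableAt_exp) (fun z hz => by
      rw [Complex.deriv_exp]; exact norm_exp_le_one hz) hy hx
  simpa using this

lemma norm_exp_sub_one_le_of_re {x : ℂ} (hx : x.re ≤ 0) : ‖Complex.exp x - 1‖ ≤ ‖x‖ := by
  simpa using norm_exp_sub_exp_le hx (y := 0) (by simp)

/-- The Taylor bound covers ‖x‖ ≤ 1; for larger x the left side is at most 2‖x‖, because exp is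
1-Lipschitz on the half-plane. -/
lemma norm_exp_sub_one_sub_le {x : ℂ} (hx : x.re ≤ 0) :
    ‖Complex.exp x - 1 - x‖ ≤ 2 * ‖x‖ ^ 2 := by
  rcases le_total ‖x‖ 1 with h | h
  · exact (Complex.norm_exp_sub_one_sub_id_le h).trans (by nlinarith [sq_nonneg ‖x‖])
  · refine (norm_sub_le _ _).trans ?_
    have := norm_exp_sub_one_le_of_re hx
    nlinarith

lemma re_exp_sub_one_le {v : ℂ} (hv : v.re ≤ 0) : (Complex.exp v - 1).re ≤ 0 := by
  have := (Complex.re_le_norm (Complex.exp v)).trans (norm_exp_le_one hv)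
  simpa using this

lemma sum_nonneg_of_mem_cube {p : Fin N → ℝ} (hp : p ∈ cube N) : 0 ≤ ∑ i, p i :=
  Finset.sum_nonneg fun i _ => (hp i).1

/-- Poisson approximation of a sum of independent Bernoulli variables. -/
lemma norm_prod_sub_exp_le {p : Fin N → ℝ} (hp : p ∈ cube N) {v : ℂ} (hv : v.re ≤ 0) {δ : ℝ}
    (hδ : 0 < δ) :
    ‖∏ i, (1 + (p i : ℂ) * (Complex.exp v - 1)) - Complex.exp ((Complex.exp v - 1) * (∑ i, p i : ℝ))‖
      ≤ δ * ∑ i, p i + 4 * ‖p‖ / δ := by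
  set w := Complex.exp v - 1
  set l := ∑ i, p i
  have hw : w.re ≤ 0 := re_exp_sub_one_le hv
  have hl : 0 ≤ l := sum_nonneg_of_mem_cube hp
  have hw2 : ‖w‖ ≤ 2 := (norm_sub_le _ _).trans (by
    have := norm_exp_le_one hv
    simp only [norm_one]; linarith)
  have h1 : ∀ i, ‖1 + (p i : ℂ) * w‖ ≤ 1 := by
    intro i
    have e : 1 + (p i : ℂ) * w = ((1 - p i : ℝ) : ℂ) + (p i : ℝ) * Complex.exp v := by
      simp only [w]; push_cast; ring
    rw [e]
    refine (norm_add_le _ _).trans ?_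
    rw [norm_mul, Complex.norm_real, Complex.norm_real, Real.norm_eq_abs, Real.norm_eq_abs,
      abs_of_nonneg (hp i).1, abs_of_nonneg (sub_nonneg.2 (hp i).2)]
    have := mul_le_of_le_one_right (hp i).1 (norm_exp_le_one hv)
    linarith
  have hre : ∀ i, ((p i : ℂ) * w).re ≤ 0 := fun i => by
    rw [Complex.re_ofReal_mul]; exact mul_nonpos_of_nonneg_of_nonpos (hp i).1 hw
  have h2 : ∀ i, ‖Complex.exp ((p i : ℂ) * w)‖ ≤ 1 := fun i => norm_exp_le_one (hre i)
  have e : Complex.exp (w * (l : ℝ)) = ∏ i, Complex.exp ((p i : ℂ) * w) := by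
    rw [← Complex.exp_sum, ← Finset.sum_mul, mul_comm]
    simp [l]
  set D := ‖∏ i, (1 + (p i : ℂ) * w) - Complex.exp (w * (l : ℝ))‖
  have hD2 : D ≤ 2 := by
    refine (norm_sub_le _ _).trans ?_
    rw [e, norm_prod, norm_prod]
    have a := Finset.prod_le_one (s := Finset.univ) (fun i _ => norm_nonneg _) fun i _ => h1 i
    have b := Finset.prod_le_one (s := Finset.univ) (fun i _ => norm_nonneg _) fun i _ => h2 i
    linarith
  have hD : D ≤ 8 * ‖p‖ * l := by
    simp only [D, e]
    refine (norm_prod_sub_prod_le _ _ _ h1 h2).trans ?_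
    simp only [l, Finset.mul_sum]
    refine Finset.sum_le_sum fun i _ => ?_
    rw [norm_sub_rev, ← sub_sub]
    refine (norm_exp_sub_one_sub_le (hre i)).trans ?_
    have hi : p i ≤ ‖p‖ := (le_abs_self _).trans (norm_le_pi_norm p i)
    rw [norm_mul, Complex.norm_real, Real.norm_eq_abs, abs_of_nonneg (hp i).1, mul_pow]
    have h3 : ‖w‖ ^ 2 ≤ 4 := by nlinarith [norm_nonneg w]
    have h4 : p i ^ 2 ≤ ‖p‖ * p i := by nlinarith [(hp i).1]
    have h5 : p i ^ 2 * ‖w‖ ^ 2 ≤ ‖p‖ * p i * 4 :=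
      mul_le_mul h4 h3 (by positivity) (mul_nonneg (norm_nonneg _) (hp i).1)
    linarith
  have hDn : 0 ≤ D := norm_nonneg _
  have hR : 0 ≤ δ * l + 4 * ‖p‖ / δ := by positivity
  refine le_of_sq_le_sq ?_ hR
  -- The product of the two bounds on D contains ‖p‖ * l, whose mean is not controlled. The
  -- inequality 4xy ≤ (x + y)² with x = δl and y = 4‖p‖/δ separates the factors, so that first
  -- moments of l and ‖p‖ suffice later.
  have h6 : D ^ 2 ≤ 16 * ‖p‖ * l := by nlinarith
  have h7 : (δ * l) * (4 * ‖p‖ / δ) = 4 * ‖p‖ * l := by field_simp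
  nlinarith [sq_nonneg (δ * l - 4 * ‖p‖ / δ)]

end InteractiveGAB

/-! ### The stationarity equation and one step of the rare-events model. -/

namespace InteractiveGAB

set_option linter.unusedSectionVars false

variable {N : ℕ} {θ : Params N}

lemma sum_weight_mul_sum_val (p : Fin N → ℝ) :
    ∑ b : Fin N → Bool, weight p b * ∑ j, val (b j) = ∑ j, p j := by
  simp only [Finset.mul_sum]
  rw [Finset.sum_comm]
  exact Finset.sum_congr rfl fun j _ => sum_weight_mul_val p j

lemma sum_weight_mul_affine (p : Fin N → ℝ) (x : ℝ) (u : Fin N → ℝ) (v : ℝ) :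
    ∑ b : Fin N → Bool, weight p b * (x + ∑ i, u i * val (b i) + v * ∑ i, val (b i))
      = x + ∑ i, u i * p i + v * ∑ i, p i := by
  simp only [mul_add, Finset.sum_add_distrib]
  rw [← Finset.sum_mul, sum_weight, one_mul]
  congr 1
  · congr 1
    simp only [Finset.mul_sum]
    rw [Finset.sum_comm]
    refine Finset.sum_congr rfl fun i _ => ?_
    rw [← sum_weight_mul_val p i, Finset.mul_sum]
    exact Finset.sum_congr rfl fun b _ => by ring
  · rw [← sum_weight_mul_sum_val, Finset.mul_sum]
    exact Finset.sum_congr rfl fun b _ => by ring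

section Stationary

variable {Ω : Type*} [MeasurableSpace Ω] {μ : Measure Ω} [IsProbabilityMeasure μ]
  {p : ℤ → Ω → Fin N → ℝ} {y : ℤ → Ω → Fin N → Bool}

/-- Stationarity equation for the expectation of a function of the success probabilities. -/
lemma IsStationarySolution.integral_eq {E : Type*} [NormedAddCommGroup E] [NormedSpace ℝ E]
    (h : IsStationarySolution θ μ p y) (hθ : θ.Admissible) (hβ : ∀ i, θ.β i < 1)
    {g : (Fin N → ℝ) → E} (hg : Continuous g) :
    ∫ ω, g (p 0 ω) ∂μ = ∫ ω, ∑ b, weight (p 0 ω) b • g (θ.step (p 0 ω) b) ∂μ := by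
  have hT := h.toIsSolution.measurable_trajectory
  have hT1 := (h.toIsSolution.shift 1).measurable_trajectory
  have hm : StronglyMeasurable fun x : Path N => g (x 0).1 :=
    hg.stronglyMeasurable.comp_measurable (by fun_prop)
  -- Shift invariance by one time unit; the recursion then expresses p_1 through p_0 and y_0.
  have e1 : ∫ ω, g (p 0 ω) ∂μ = ∫ ω, g (p 1 ω) ∂μ := by
    have a := integral_map hT.aemeasurable (hm.aestronglyMeasurable (μ := μ.map (trajectory p y)))
    have b := integral_map hT1.aemeasurable (hm.aestronglyMeasurable
      (μ := μ.map (trajectory (fun t => p (t + 1)) fun t => y (t + 1))))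
    rw [h.stationary 1, a] at b
    simpa only [trajectory, zero_add] using b
  have hc := fun b => hg.comp (θ.continuous_step b)
  rw [e1, ← h.integral_comp_eq hθ hβ 0 (f := fun x b => g (θ.step x b))
    (fun b => (hc b).stronglyMeasurable) fun b => h.integrable_comp 0 (hc b)]
  refine integral_congr_ae ?_
  filter_upwards [h.recursion 1] with ω hω
  rw [hω, sub_self]

end Stationary

/-- The bounds on the parameters of the rare-events scaling. -/
structure RareBounds (c a γ : ℕ → ℝ) (β κ C Cbar : ℝ) : Prop where
  κ_pos : 0 < κ
  c_mem : ∀ i, 0 ≤ c i ∧ c i ≤ C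
  a_mem : ∀ i, 0 ≤ a i ∧ a i ≤ C
  γ_nonneg : ∀ i, 0 ≤ γ i
  β_nonneg : 0 ≤ β
  lt_one : Cbar < 1
  add_lt : ∀ i, β + γ i < Cbar

/-- The average of the first `N` terms. -/
noncomputable def avg (x : ℕ → ℝ) (N : ℕ) : ℝ := (1 / (N : ℝ)) * ∑ i ∈ Finset.range N, x i

lemma avg_mem {x : ℕ → ℝ} {l u : ℝ} (hx : ∀ i, x i ∈ Set.Icc l u) (hN : 0 < N) :
    avg x N ∈ Set.Icc l u := by
  have hN' : (0 : ℝ) < N := by exact_mod_cast hN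
  have h1 := Finset.card_nsmul_le_sum (Finset.range N) x l fun i _ => (hx i).1
  have h2 := Finset.sum_le_card_nsmul (Finset.range N) x u fun i _ => (hx i).2
  rw [Finset.card_range, nsmul_eq_mul] at h1 h2
  rw [avg, one_div, ← div_eq_inv_mul]
  exact ⟨(le_div_iff₀ hN').2 (by linarith), (div_le_iff₀ hN').2 (by linarith)⟩

/-- The rate at which the individual effects vanish. -/
noncomputable def rate (κ : ℝ) (N : ℕ) : ℝ := 1 / (N : ℝ) + 1 / (N : ℝ) ^ κ

lemma tendsto_one_div_rpow {κ : ℝ} (hκ : 0 < κ) :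
    Tendsto (fun N : ℕ => 1 / (N : ℝ) ^ κ) atTop (𝓝 0) := by
  simp only [one_div]
  exact ((tendsto_rpow_atTop hκ).comp tendsto_natCast_atTop_atTop).inv_tendsto_atTop

lemma tendsto_rate {κ : ℝ} (hκ : 0 < κ) : Tendsto (rate κ) atTop (𝓝 0) := by
  have := (tendsto_one_div_atTop_nhds_zero_nat (𝕜 := ℝ)).add (tendsto_one_div_rpow hκ)
  rwa [add_zero] at this

namespace RareBounds

variable {c a γ : ℕ → ℝ} {β κ C Cbar : ℝ}

lemma C_nonneg (H : RareBounds c a γ β κ C Cbar) : 0 ≤ C := (H.c_mem 0).1.trans (H.c_mem 0).2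

lemma β_lt_one (H : RareBounds c a γ β κ C Cbar) : β < 1 := by
  have := H.add_lt 0; have := H.γ_nonneg 0; have := H.lt_one; linarith

lemma Cbar_nonneg (H : RareBounds c a γ β κ C Cbar) : 0 ≤ Cbar := by
  have := H.add_lt 0; have := H.γ_nonneg 0; have := H.β_nonneg; linarith

lemma avg_γ_mem (H : RareBounds c a γ β κ C Cbar) (hN : 0 < N) :
    avg γ N ∈ Set.Icc 0 (Cbar - β) :=
  avg_mem (fun i => ⟨H.γ_nonneg i, by have := H.add_lt i; linarith⟩) hN

lemma avg_c_mem (H : RareBounds c a γ β κ C Cbar) (hN : 0 < N) : avg c N ∈ Set.Icc 0 C :=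
  avg_mem (fun i => H.c_mem i) hN

/-- The condition that the dimension is large. -/
def Large (_ : RareBounds c a γ β κ C Cbar) (N : ℕ) : Prop := 0 < N ∧ C * rate κ N ≤ (1 - Cbar) / 2

lemma eventually_large (H : RareBounds c a γ β κ C Cbar) : ∀ᶠ N in atTop, H.Large N := by
  have h1 : Tendsto (fun N => C * rate κ N) atTop (𝓝 0) := by
    simpa using (tendsto_rate H.κ_pos).const_mul C
  have h2 : (0 : ℝ) < (1 - Cbar) / 2 := by have := H.lt_one; linarith
  filter_upwards [h1.eventually_le_const h2, eventually_gt_atTop 0] with N h3 h4 using ⟨h4, h3⟩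

lemma large_bounds (H : RareBounds c a γ β κ C Cbar) (hN : H.Large N) :
    0 ≤ C / (N : ℝ) ∧ 0 ≤ C / (N : ℝ) ^ κ ∧ C / (N : ℝ) + C / (N : ℝ) ^ κ ≤ (1 - Cbar) / 2 := by
  have := H.C_nonneg
  refine ⟨by positivity, by positivity, ?_⟩
  have h := hN.2
  rw [rate] at h
  calc C / (N : ℝ) + C / (N : ℝ) ^ κ = C * (1 / N + 1 / (N : ℝ) ^ κ) := by ring
    _ ≤ _ := h

lemma admissible (H : RareBounds c a γ β κ C Cbar) (hN : H.Large N) :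
    (rareEvents c a γ β κ N).Admissible := by
  intro i
  obtain ⟨h1, h2, h3⟩ := H.large_bounds hN
  have hNn : (0 : ℝ) ≤ N := Nat.cast_nonneg _
  have hNk : (0 : ℝ) ≤ (N : ℝ) ^ κ := by positivity
  have h4 := H.add_lt i
  have h5 := H.lt_one
  have h6 : c i / (N : ℝ) ≤ C / N := div_le_div_of_nonneg_right (H.c_mem i).2 hNn
  have h7 : a i / (N : ℝ) ^ κ ≤ C / (N : ℝ) ^ κ := div_le_div_of_nonneg_right (H.a_mem i).2 hNk
  refine ⟨div_nonneg (H.c_mem i).1 hNn, div_nonneg (H.a_mem i).1 hNk, H.γ_nonneg i, H.β_nonneg, ?_⟩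
  simp only [rareEvents]
  linarith

/-- The averaged γ plus β is at most Cbar, and `Large` lets the individual effects use half of the
remaining gap 1 - Cbar. -/
lemma contracting (H : RareBounds c a γ β κ C Cbar) (hN : H.Large N) :
    (rareEvents c a γ β κ N).Contracting ((1 + Cbar) / 2) := by
  intro i
  obtain ⟨h1, h2, h3⟩ := H.large_bounds hN
  have hNk : (0 : ℝ) ≤ (N : ℝ) ^ κ := by positivity
  have h4 := (H.avg_γ_mem hN.1).2
  have h7 : a i / (N : ℝ) ^ κ ≤ C / (N : ℝ) ^ κ := div_le_div_of_nonneg_right (H.a_mem i).2 hNk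
  rw [avg, ← Fin.sum_univ_eq_sum_range] at h4
  simp only [rareEvents]
  linarith

lemma sum_step (N : ℕ) (p : Fin N → ℝ) (b : Fin N → Bool) :
    ∑ i, (rareEvents c a γ β κ N).step p b i
      = (avg c N + β * ∑ i, p i) + ∑ i : Fin N, a i / (N : ℝ) ^ κ * val (b i)
        + avg γ N * ∑ i, val (b i) := by
  simp only [Params.step, rareEvents, Finset.sum_add_distrib, avg]
  rw [← Finset.sum_mul, ← Finset.mul_sum, ← Fin.sum_univ_eq_sum_range c,
    ← Fin.sum_univ_eq_sum_range γ, ← Finset.sum_div]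
  ring

lemma sum_a_mul_le (H : RareBounds c a γ β κ C Cbar) (N : ℕ) {x : Fin N → ℝ} (hx : ∀ i, 0 ≤ x i) :
    ∑ i : Fin N, a i / (N : ℝ) ^ κ * x i ∈ Set.Icc 0 (C / (N : ℝ) ^ κ * ∑ i, x i) := by
  have hNk : (0 : ℝ) ≤ (N : ℝ) ^ κ := by positivity
  refine ⟨Finset.sum_nonneg fun i _ => mul_nonneg (div_nonneg (H.a_mem i).1 hNk) (hx i), ?_⟩
  rw [Finset.mul_sum]
  exact Finset.sum_le_sum fun i _ =>
    mul_le_mul_of_nonneg_right (div_le_div_of_nonneg_right (H.a_mem i).2 hNk) (hx i)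

/-- The coefficient of ‖p‖ is β < 1, so under stationarity the bound closes on the mean of ‖p‖. The
interaction term is only the fraction of successes, whose mean is of order 1/N. -/
lemma norm_step_le (H : RareBounds c a γ β κ C Cbar) (hN : H.Large N) {p : Fin N → ℝ}
    (hp : p ∈ cube N) (b : Fin N → Bool) :
    ‖(rareEvents c a γ β κ N).step p b‖
      ≤ (C * rate κ N + β * ‖p‖) + 1 / (N : ℝ) * ∑ i, val (b i) := by
  have hC := H.C_nonneg
  have hb := H.β_nonneg
  have hv : 0 ≤ 1 / (N : ℝ) * ∑ i, val (b i) := (mean_val_mem b).1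
  have hr : 0 ≤ rate κ N := by unfold rate; positivity
  refine (pi_norm_le_iff_of_nonneg (by positivity)).2 fun i => ?_
  rw [Real.norm_eq_abs, abs_of_nonneg ((Params.step_mem_cube (H.admissible hN) hp b i).1)]
  have hNn : (0 : ℝ) ≤ N := Nat.cast_nonneg _
  have hNk : (0 : ℝ) ≤ (N : ℝ) ^ κ := by positivity
  have h1 : c i / (N : ℝ) ≤ C / N := div_le_div_of_nonneg_right (H.c_mem i).2 hNn
  have h2 : a i / (N : ℝ) ^ κ * val (b i) ≤ C / (N : ℝ) ^ κ :=
    (mul_le_of_le_one_right (div_nonneg (H.a_mem i).1 hNk) (val_le_one _)).trans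
      (div_le_div_of_nonneg_right (H.a_mem i).2 hNk)
  have hg : γ i ≤ 1 := by have := H.add_lt i; have := H.lt_one; linarith
  have h3 := mul_le_of_le_one_left hv hg
  have h4 : β * p i ≤ β * ‖p‖ :=
    mul_le_mul_of_nonneg_left ((le_abs_self _).trans (norm_le_pi_norm p i)) hb
  have h5 : C * rate κ N = C / N + C / (N : ℝ) ^ κ := by rw [rate]; ring
  simp only [Params.step, rareEvents]
  linarith

/-- The exponent map of the limiting Poisson autoregression. -/
noncomputable def expMap (g β : ℝ) (z : ℂ) : ℂ := β * z + (Complex.exp (g * z) - 1)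

lemma expMap_re {g β : ℝ} (hg : 0 ≤ g) (hβ : 0 ≤ β) {z : ℂ} (hz : z.re ≤ 0) :
    (expMap g β z).re ≤ 0 := by
  have h1 : ((g : ℂ) * z).re ≤ 0 := by
    rw [Complex.re_ofReal_mul]; exact mul_nonpos_of_nonneg_of_nonpos hg hz
  have h2 : ((β : ℂ) * z).re ≤ 0 := by
    rw [Complex.re_ofReal_mul]; exact mul_nonpos_of_nonneg_of_nonpos hβ hz
  rw [expMap, Complex.add_re]
  exact add_nonpos h2 (re_exp_sub_one_le h1)

/-- One step of the recursion approximately acts on exponentials as in the limit. -/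
lemma norm_sum_weight_exp_sub_le (H : RareBounds c a γ β κ C Cbar) (hN : H.Large N) {p : Fin N → ℝ}
    (hp : p ∈ cube N) {cbar g : ℝ} (hc : 0 ≤ cbar) (hg : 0 ≤ g) {z : ℂ} (hz : z.re ≤ 0) {δ : ℝ}
    (hδ : 0 < δ) :
    ‖∑ b, weight p b • Complex.exp (z * (∑ i, (rareEvents c a γ β κ N).step p b i : ℝ))
        - Complex.exp (z * cbar) * Complex.exp (expMap g β z * (∑ i, p i : ℝ))‖
      ≤ ‖z‖ * (|avg c N - cbar| + C / (N : ℝ) ^ κ * ∑ i, p i + |avg γ N - g| * ∑ i, p i)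
        + (δ * ∑ i, p i + 4 * ‖p‖ / δ) := by
  have hl := sum_nonneg_of_mem_cube hp
  have hmul : ∀ x : ℝ, 0 ≤ x → (z * (x : ℂ)).re ≤ 0 := fun x hx => by
    rw [Complex.re_mul_ofReal]; exact mul_nonpos_of_nonpos_of_nonneg hz hx
  set S : (Fin N → Bool) → ℝ := fun b => ∑ i, val (b i)
  have hS : ∀ b, 0 ≤ S b := fun b => Finset.sum_nonneg fun i _ => val_nonneg _
  set l := ∑ i, p i
  -- With the limiting coefficients and no individual effect, the exponent is affine in the number
  -- of successes, so the average factorises into Bernoulli generating functions.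
  have hlim : ∑ b, weight p b • Complex.exp (z * (cbar + β * l + g * S b : ℝ))
      = Complex.exp (z * (cbar + β * l : ℝ)) * ∏ i, (1 + (p i : ℂ) * (Complex.exp (g * z) - 1)) := by
    have e : ∀ b, weight p b • Complex.exp (z * (cbar + β * l + g * S b : ℝ))
        = Complex.exp (z * (cbar + β * l : ℝ)) *
          (weight p b * ∏ i, Complex.exp (g * z * val (b i))) := by
      intro b
      rw [← Complex.exp_sum, ← Finset.mul_sum, Complex.real_smul]
      have : z * (cbar + β * l + g * S b : ℝ) = z * (cbar + β * l : ℝ) +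
          g * z * ∑ i, (val (b i) : ℂ) := by
        simp only [S]; push_cast; ring
      rw [this, Complex.exp_add]
      ring
    simp only [e]
    rw [← Finset.mul_sum, sum_weight_mul_prod p fun _ b => Complex.exp (g * z * val b)]
    congr 1
    refine Finset.prod_congr rfl fun i _ => ?_
    simp only [val]
    simp
    ring
  have hA : ‖∑ b, weight p b • Complex.exp (z * (∑ i, (rareEvents c a γ β κ N).step p b i : ℝ))
        - ∑ b, weight p b • Complex.exp (z * (cbar + β * l + g * S b : ℝ))‖
      ≤ ‖z‖ * (|avg c N - cbar| + C / (N : ℝ) ^ κ * l + |avg γ N - g| * l) := by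
    rw [← Finset.sum_sub_distrib]
    -- Writing the error bound as an average over outcomes reduces the claim to a comparison for
    -- each outcome.
    have e : ‖z‖ * (|avg c N - cbar| + C / (N : ℝ) ^ κ * l + |avg γ N - g| * l)
        = ∑ b, weight p b * (‖z‖ * (|avg c N - cbar| +
          ∑ i : Fin N, C / (N : ℝ) ^ κ * val (b i) + |avg γ N - g| * ∑ i, val (b i))) := by
      simp only [mul_left_comm _ ‖z‖]
      rw [← Finset.mul_sum, sum_weight_mul_affine p, ← Finset.mul_sum]
    rw [e]
    refine (norm_sum_le _ _).trans (Finset.sum_le_sum fun b _ => ?_)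
    rw [← smul_sub, norm_smul, Real.norm_eq_abs, abs_of_nonneg (weight_nonneg hp b)]
    refine mul_le_mul_of_nonneg_left ?_ (weight_nonneg hp b)
    have hst : 0 ≤ ∑ i, (rareEvents c a γ β κ N).step p b i :=
      sum_nonneg_of_mem_cube (Params.step_mem_cube (H.admissible hN) hp b)
    have hlm : 0 ≤ cbar + β * l + g * S b := by
      have := H.β_nonneg; have := hS b; positivity
    refine (norm_exp_sub_exp_le (hmul _ hst) (hmul _ hlm)).trans ?_
    rw [← mul_sub, norm_mul, ← Complex.ofReal_sub, Complex.norm_real, Real.norm_eq_abs]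
    refine mul_le_mul_of_nonneg_left ?_ (norm_nonneg z)
    have e2 : ∑ i, (rareEvents c a γ β κ N).step p b i - (cbar + β * l + g * S b)
        = (avg c N - cbar) + ∑ i : Fin N, a i / (N : ℝ) ^ κ * val (b i) + (avg γ N - g) * S b := by
      rw [sum_step]; simp only [l, S]; ring
    have h3 := H.sum_a_mul_le N (x := fun i => val (b i)) fun i => val_nonneg _
    rw [e2]
    refine (abs_add_le _ _).trans (add_le_add ((abs_add_le _ _).trans (add_le_add le_rfl ?_)) ?_)
    · rw [abs_of_nonneg h3.1, ← Finset.mul_sum]; exact h3.2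
    · rw [abs_mul, abs_of_nonneg (hS b)]
  -- Poisson approximation replaces the product by exp((exp(gz) - 1) l), which together with βz
  -- forms `expMap`.
  have hB : ‖∑ b, weight p b • Complex.exp (z * (cbar + β * l + g * S b : ℝ))
        - Complex.exp (z * cbar) * Complex.exp (expMap g β z * (l : ℝ))‖
      ≤ δ * l + 4 * ‖p‖ / δ := by
    have e : Complex.exp (z * cbar) * Complex.exp (expMap g β z * (l : ℝ))
        = Complex.exp (z * (cbar + β * l : ℝ)) * Complex.exp ((Complex.exp (g * z) - 1) * (l : ℝ)) := by
      rw [← Complex.exp_add, ← Complex.exp_add, expMap]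
      congr 1; push_cast; ring
    rw [hlim, e, ← mul_sub, norm_mul]
    have hlm : 0 ≤ cbar + β * l := by have := H.β_nonneg; positivity
    have hgz : ((g : ℂ) * z).re ≤ 0 := by rw [mul_comm]; exact hmul g hg
    exact (mul_le_of_le_one_left (norm_nonneg _) (norm_exp_le_one (hmul _ hlm))).trans
      (norm_prod_sub_exp_le hp hgz hδ)
  exact (norm_sub_le_norm_sub_add_norm_sub _ _ _).trans (add_le_add hA hB)

end RareBounds

end InteractiveGAB

/-! ### Moment bounds and the approximate functional equation. -/

namespace InteractiveGAB

lemma integral_affine {Ω : Type*} [MeasurableSpace Ω] {μ : Measure Ω} [IsProbabilityMeasure μ]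
    {f g : Ω → ℝ} (hf : Integrable f μ) (hg : Integrable g μ) (r s t : ℝ) :
    ∫ ω, (r + s * f ω + t * g ω) ∂μ = r + s * ∫ ω, f ω ∂μ + t * ∫ ω, g ω ∂μ := by
  have h1 : Integrable (fun ω => r + s * f ω) μ := (integrable_const _).add (hf.const_mul _)
  rw [integral_add h1 (hg.const_mul t), integral_add (integrable_const _) (hf.const_mul s),
    integral_const_mul, integral_const_mul, integral_const, probReal_univ, one_smul]

namespace RareBounds

set_option linter.unusedSectionVars false

variable {N : ℕ} {c a γ : ℕ → ℝ} {β κ C Cbar : ℝ}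
  {Ω : Type*} [MeasurableSpace Ω] {μ : Measure Ω} [IsProbabilityMeasure μ]
  {p : ℤ → Ω → Fin N → ℝ} {y : ℤ → Ω → Fin N → Bool}

lemma integral_sum_nonneg (h : IsStationarySolution (rareEvents c a γ β κ N) μ p y) :
    0 ≤ ∫ ω, ∑ i, p 0 ω i ∂μ :=
  integral_nonneg_of_ae ((h.mem_cube 0).mono fun _ => sum_nonneg_of_mem_cube)

/-- The stationarity equation for the mean. -/
lemma abs_mean_sub_le (H : RareBounds c a γ β κ C Cbar) (hN : H.Large N)
    (h : IsStationarySolution (rareEvents c a γ β κ N) μ p y) :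
    (1 - avg γ N - β) * ∫ ω, ∑ i, p 0 ω i ∂μ
      ∈ Set.Icc (avg c N) (avg c N + C / (N : ℝ) ^ κ * ∫ ω, ∑ i, p 0 ω i ∂μ) := by
  have hc : Continuous fun x : Fin N → ℝ => ∑ i, x i := by fun_prop
  have hi : Integrable (fun ω => ∑ i, p 0 ω i) μ := h.integrable_comp 0 hc
  have e := h.integral_eq (H.admissible hN) (fun _ => H.β_lt_one) hc
  simp only [smul_eq_mul, sum_step, sum_weight_mul_affine] at e
  have hi' : Integrable (fun ω => avg c N + β * ∑ i, p 0 ω i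
      + ∑ i : Fin N, a i / (N : ℝ) ^ κ * p 0 ω i + avg γ N * ∑ i, p 0 ω i) μ :=
    h.integrable_comp 0 (w := fun x : Fin N → ℝ => avg c N + β * ∑ i, x i
      + ∑ i : Fin N, a i / (N : ℝ) ^ κ * x i + avg γ N * ∑ i, x i) (by fun_prop)
  set M := ∫ ω, ∑ i, p 0 ω i ∂μ with hM
  have lin : ∀ r s : ℝ, ∫ ω, (r + s * ∑ i, p 0 ω i) ∂μ = r + s * M := fun r s => by
    rw [integral_add (integrable_const _) (hi.const_mul s), integral_const_mul]; simp [hM]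
  have ilin : ∀ r s : ℝ, Integrable (fun ω => r + s * ∑ i, p 0 ω i) μ := fun r s =>
    (integrable_const _).add (hi.const_mul s)
  have hb : ∀ᵐ ω ∂μ, ∑ i : Fin N, a i / (N : ℝ) ^ κ * p 0 ω i
      ∈ Set.Icc 0 (C / (N : ℝ) ^ κ * ∑ i, p 0 ω i) := by
    filter_upwards [h.mem_cube 0] with ω hω using H.sum_a_mul_le N fun i => (hω i).1
  have l : avg c N + (β + avg γ N) * M ≤ M := by
    rw [← lin]
    refine (integral_mono_ae (ilin _ _) hi' ?_).trans e.symm.le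
    filter_upwards [hb] with ω hω
    have := hω.1
    linarith
  have u : M ≤ avg c N + (β + avg γ N + C / (N : ℝ) ^ κ) * M := by
    rw [← lin]
    refine e.le.trans (integral_mono_ae hi' (ilin _ _) ?_)
    filter_upwards [hb] with ω hω
    have := hω.2
    linarith
  constructor <;> linarith

/-- An upper bound for the mean of the sum of the success probabilities. -/
noncomputable def meanBound (_ : RareBounds c a γ β κ C Cbar) : ℝ := 2 * C / (1 - Cbar)

/-- In the mean equation the left coefficient is at least 1 - Cbar, while the individual effects
take back at most (1 - Cbar)/2 for large N. -/
lemma mean_le (H : RareBounds c a γ β κ C Cbar) (hN : H.Large N)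
    (h : IsStationarySolution (rareEvents c a γ β κ N) μ p y) :
    ∫ ω, ∑ i, p 0 ω i ∂μ ≤ H.meanBound := by
  obtain ⟨h1, h2⟩ := H.abs_mean_sub_le hN h
  have hM := integral_sum_nonneg h
  set M := ∫ ω, ∑ i, p 0 ω i ∂μ
  obtain ⟨h3, h4, h5⟩ := H.large_bounds hN
  have h6 := (H.avg_γ_mem hN.1).2
  have h7 := (H.avg_c_mem hN.1).2
  have h8 := H.lt_one
  rw [meanBound, le_div_iff₀ (by linarith)]
  have h9 : (1 - Cbar) * M ≤ (1 - avg γ N - β) * M := mul_le_mul_of_nonneg_right (by linarith) hM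
  have h10 : C / (N : ℝ) ^ κ * M ≤ (1 - Cbar) / 2 * M := mul_le_mul_of_nonneg_right (by linarith) hM
  linarith

/-- The constant in the bound for the largest success probability. -/
noncomputable def normBound (H : RareBounds c a γ β κ C Cbar) : ℝ := (C + H.meanBound) / (1 - β)

lemma integral_norm_le (H : RareBounds c a γ β κ C Cbar) (hN : H.Large N)
    (h : IsStationarySolution (rareEvents c a γ β κ N) μ p y) :
    ∫ ω, ‖p 0 ω‖ ∂μ ≤ H.normBound * rate κ N := by
  have e := h.integral_eq (H.admissible hN) (fun _ => H.β_lt_one)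
    (g := fun x : Fin N → ℝ => ‖x‖) continuous_norm
  have hi : Integrable (fun ω => ‖p 0 ω‖) μ := h.integrable_comp 0 continuous_norm
  have hs : Integrable (fun ω => ∑ i, p 0 ω i) μ :=
    h.integrable_comp 0 (w := fun x : Fin N → ℝ => ∑ i, x i) (by fun_prop)
  simp only [smul_eq_mul] at e
  have hi' : Integrable (fun ω => ∑ b, weight (p 0 ω) b *
      ‖(rareEvents c a γ β κ N).step (p 0 ω) b‖) μ :=
    h.integrable_comp 0 (w := fun x : Fin N → ℝ => ∑ b, weight x b *
      ‖(rareEvents c a γ β κ N).step x b‖)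
      (continuous_finsetSum _ fun b _ => (continuous_weight b).mul (Params.continuous_step b).norm)
  have hle : ∫ ω, ‖p 0 ω‖ ∂μ
      ≤ C * rate κ N + β * ∫ ω, ‖p 0 ω‖ ∂μ + 1 / (N : ℝ) * ∫ ω, ∑ i, p 0 ω i ∂μ := by
    rw [← integral_affine hi hs]
    refine e.le.trans (integral_mono_ae hi'
      (((integrable_const _).add (hi.const_mul β)).add (hs.const_mul _)) ?_)
    filter_upwards [h.mem_cube 0] with ω hω
    -- The sum with zero coefficients only gives the expression the form required by
    -- `sum_weight_mul_affine`.
    calc ∑ b, weight (p 0 ω) b * ‖(rareEvents c a γ β κ N).step (p 0 ω) b‖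
        ≤ ∑ b, weight (p 0 ω) b * ((C * rate κ N + β * ‖p 0 ω‖) + ∑ i : Fin N, 0 * val (b i)
            + 1 / (N : ℝ) * ∑ i, val (b i)) :=
          Finset.sum_le_sum fun b _ => mul_le_mul_of_nonneg_left
            (by simpa using H.norm_step_le hN hω b) (weight_nonneg hω b)
      _ = _ := by rw [sum_weight_mul_affine _ _ fun _ => 0]; simp
  have h1 := H.mean_le hN h
  have h2 := integral_sum_nonneg h
  have h3 : 1 / (N : ℝ) ≤ rate κ N := by
    have : 0 ≤ 1 / (N : ℝ) ^ κ := by positivity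
    rw [rate]; linarith
  have h4 : 1 / (N : ℝ) * ∫ ω, ∑ i, p 0 ω i ∂μ ≤ rate κ N * H.meanBound :=
    mul_le_mul h3 h1 h2 ((by positivity : (0 : ℝ) ≤ 1 / (N : ℝ)).trans h3)
  have h5 := H.β_lt_one
  rw [normBound, div_mul_eq_mul_div, le_div_iff₀ (by linarith)]
  linarith

/-- The error in the stationarity equation for exponentials. -/
noncomputable def expError (H : RareBounds c a γ β κ C Cbar) (cbar g : ℝ) (z : ℂ) (N : ℕ) : ℝ :=
  ‖z‖ * (|avg c N - cbar| + C / (N : ℝ) ^ κ * H.meanBound + |avg γ N - g| * H.meanBound)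
    + (√(rate κ N) * H.meanBound + 4 * H.normBound * √(rate κ N))

lemma tendsto_expError (H : RareBounds c a γ β κ C Cbar) {cbar g : ℝ}
    (hc : Tendsto (avg c) atTop (𝓝 cbar)) (hg : Tendsto (avg γ) atTop (𝓝 g)) (z : ℂ) :
    Tendsto (H.expError cbar g z) atTop (𝓝 0) := by
  have h1 : Tendsto (fun N => √(rate κ N)) atTop (𝓝 0) := by
    simpa using (tendsto_rate H.κ_pos).sqrt
  have h2 : Tendsto (fun N => |avg c N - cbar|) atTop (𝓝 0) := by
    simpa using (hc.sub_const cbar).abs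
  have h3 : Tendsto (fun N => |avg γ N - g|) atTop (𝓝 0) := by
    simpa using (hg.sub_const g).abs
  have h4 : Tendsto (fun N : ℕ => C / (N : ℝ) ^ κ) atTop (𝓝 0) := by
    simpa [div_eq_mul_inv] using (tendsto_one_div_rpow H.κ_pos).const_mul C
  have := (((h2.add (h4.mul_const H.meanBound)).add (h3.mul_const H.meanBound)).const_mul ‖z‖).add
    ((h1.mul_const H.meanBound).add (h1.const_mul (4 * H.normBound)))
  simp only [zero_mul, mul_zero, add_zero] at this
  exact this

lemma norm_integral_exp_sub_le (H : RareBounds c a γ β κ C Cbar) (hN : H.Large N)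
    (h : IsStationarySolution (rareEvents c a γ β κ N) μ p y) {cbar g : ℝ} (hc : 0 ≤ cbar)
    (hg : 0 ≤ g) {z : ℂ} (hz : z.re ≤ 0) :
    ‖∫ ω, Complex.exp (z * (∑ i, p 0 ω i : ℝ)) ∂μ
        - Complex.exp (z * cbar) * ∫ ω, Complex.exp (expMap g β z * (∑ i, p 0 ω i : ℝ)) ∂μ‖
      ≤ H.expError cbar g z N := by
  have hr : 0 < rate κ N := by
    have : (0 : ℝ) < N := by exact_mod_cast hN.1
    unfold rate; positivity
  have hcont : ∀ w : ℂ, Continuous fun x : Fin N → ℝ => Complex.exp (w * (∑ i, x i : ℝ)) :=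
    fun w => by fun_prop
  have e := h.integral_eq (H.admissible hN) (fun _ => H.β_lt_one) (hcont z)
  have hi1 : Integrable (fun ω => ∑ b, weight (p 0 ω) b •
      Complex.exp (z * (∑ i, (rareEvents c a γ β κ N).step (p 0 ω) b i : ℝ))) μ :=
    h.integrable_comp 0 (w := fun x : Fin N → ℝ => ∑ b, weight x b •
      Complex.exp (z * (∑ i, (rareEvents c a γ β κ N).step x b i : ℝ)))
      (continuous_finsetSum _ fun b _ =>
        (continuous_weight b).smul ((hcont z).comp (Params.continuous_step b)))
  have hi2 : Integrable (fun ω => Complex.exp (expMap g β z * (∑ i, p 0 ω i : ℝ))) μ :=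
    h.integrable_comp 0 (hcont (expMap g β z))
  have hs : Integrable (fun ω => ∑ i, p 0 ω i) μ :=
    h.integrable_comp 0 (w := fun x : Fin N → ℝ => ∑ i, x i) (by fun_prop)
  have hn : Integrable (fun ω => ‖p 0 ω‖) μ := h.integrable_comp 0 continuous_norm
  rw [e, ← integral_const_mul, ← integral_sub hi1 (hi2.const_mul _)]
  set u := |avg c N - cbar|
  set v := C / (N : ℝ) ^ κ
  set w := |avg γ N - g|
  -- This choice balances the Poisson error: E∑p is bounded and E‖p‖ is O(rate), so both δ E∑p and 4
  -- E‖p‖ / δ are O(√rate).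
  set δ := √(rate κ N)
  have hδ : 0 < δ := Real.sqrt_pos.2 hr
  have hδ2 : δ * δ = rate κ N := Real.mul_self_sqrt hr.le
  have hI : Integrable (fun ω => ‖z‖ * u + (‖z‖ * v + ‖z‖ * w + δ) * ∑ i, p 0 ω i
      + 4 / δ * ‖p 0 ω‖) μ :=
    ((integrable_const _).add (hs.const_mul _)).add (hn.const_mul _)
  refine (norm_integral_le_of_norm_le hI ?_).trans ?_
  · filter_upwards [h.mem_cube 0] with ω hω
    refine (H.norm_sum_weight_exp_sub_le hN hω hc hg hz hδ).trans (le_of_eq ?_)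
    simp only [u, v, w]; ring
  · rw [integral_affine hs hn]
    have h1 := H.mean_le hN h
    have h2 := H.integral_norm_le hN h
    have h3 : (‖z‖ * v + ‖z‖ * w + δ) * ∫ ω, ∑ i, p 0 ω i ∂μ
        ≤ (‖z‖ * v + ‖z‖ * w + δ) * H.meanBound := by
      refine mul_le_mul_of_nonneg_left h1 ?_
      have : 0 ≤ v := (H.large_bounds hN).2.1
      positivity
    have h4 : 4 / δ * ∫ ω, ‖p 0 ω‖ ∂μ ≤ 4 * H.normBound * δ := by
      refine (mul_le_mul_of_nonneg_left h2 (by positivity)).trans (le_of_eq ?_)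
      rw [← hδ2]; field_simp
    have h5 : H.expError cbar g z N = ‖z‖ * u + (‖z‖ * v + ‖z‖ * w + δ) * H.meanBound
        + 4 * H.normBound * δ := by
      simp only [expError, u, v, w, δ]; ring
    rw [h5]
    linarith

end RareBounds

end InteractiveGAB

/-! ### Transforms on the left half-plane and the mean of the limit. -/

namespace InteractiveGAB

open RareBounds

/-- The contraction that drives the limit theorem. `expMap` leads off the imaginary axis into the
half-plane, so characteristic functions alone would not be closed under the functional equation. -/
lemma norm_expMap_le {g β : ℝ} (hg : 0 ≤ g) (hβ : 0 ≤ β) {z : ℂ} (hz : z.re ≤ 0) :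
    ‖expMap g β z‖ ≤ (g + β) * ‖z‖ := by
  have h1 : ((g : ℂ) * z).re ≤ 0 := by
    rw [Complex.re_ofReal_mul]; exact mul_nonpos_of_nonneg_of_nonpos hg hz
  refine (norm_add_le _ _).trans ?_
  have h2 := norm_exp_sub_one_le_of_re h1
  rw [norm_mul, Complex.norm_real, Real.norm_eq_abs, abs_of_nonneg hg] at h2
  rw [norm_mul, Complex.norm_real, Real.norm_eq_abs, abs_of_nonneg hβ]
  linarith

section Laplace

variable {ν : Measure ℝ} [IsProbabilityMeasure ν]

lemma re_mul_nonpos {z : ℂ} (hz : z.re ≤ 0) {x : ℝ} (hx : 0 ≤ x) : (z * (x : ℂ)).re ≤ 0 := by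
  rw [Complex.re_mul_ofReal]; exact mul_nonpos_of_nonpos_of_nonneg hz hx

lemma integrable_cexp (h0 : ∀ᵐ x ∂ν, 0 ≤ x) {z : ℂ} (hz : z.re ≤ 0) :
    Integrable (fun x : ℝ => Complex.exp (z * x)) ν := by
  refine Integrable.of_bound (C := 1) (by fun_prop) ?_
  filter_upwards [h0] with x hx using norm_exp_le_one (re_mul_nonpos hz hx)

/-- Near 0 the transform is close to 1, uniformly over laws with bounded mean; this is what the
iterated functional equation is compared with. -/
lemma norm_integral_cexp_sub_one_le (h0 : ∀ᵐ x ∂ν, 0 ≤ x) (hi : Integrable (fun x : ℝ => x) ν)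
    {z : ℂ} (hz : z.re ≤ 0) : ‖∫ x : ℝ, Complex.exp (z * x) ∂ν - 1‖ ≤ ‖z‖ * ∫ x, x ∂ν := by
  have : (1 : ℂ) = ∫ _ : ℝ, (1 : ℂ) ∂ν := by simp
  rw [this, ← integral_sub (integrable_cexp h0 hz) (integrable_const _), ← integral_const_mul]
  refine norm_integral_le_of_norm_le (hi.const_mul _) ?_
  filter_upwards [h0] with x hx
  refine (norm_exp_sub_one_le_of_re (re_mul_nonpos hz hx)).trans (le_of_eq ?_)
  rw [norm_mul, Complex.norm_real, Real.norm_eq_abs, abs_of_nonneg hx]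

/-- The right derivative at `0` of the Laplace transform is minus the mean. -/
lemma hasDerivWithinAt_laplace (h0 : ∀ᵐ x ∂ν, 0 ≤ x) (hi : Integrable (fun x : ℝ => x) ν) :
    HasDerivWithinAt (fun u : ℝ => ∫ x, Real.exp (-u * x) ∂ν) (-∫ x, x ∂ν) (Set.Ici 0) 0 := by
  rw [← hasDerivWithinAt_Ioi_iff_Ici, hasDerivWithinAt_iff_tendsto_slope' (by simp), ← integral_neg]
  have hb : ∀ u : ℝ, 0 < u → ∀ x : ℝ, 0 ≤ x → |Real.exp (-u * x) - 1| ≤ u * x := by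
    intro u hu x hx
    have h1 := Real.add_one_le_exp (-u * x)
    have h2 : Real.exp (-u * x) ≤ 1 := Real.exp_le_one_iff.2 (by nlinarith)
    rw [abs_le]; constructor <;> nlinarith
  have hI : ∀ u : ℝ, 0 ≤ u → Integrable (fun x => Real.exp (-u * x)) ν := by
    intro u hu
    refine Integrable.of_bound (C := 1) (by fun_prop) ?_
    filter_upwards [h0] with x hx
    rw [Real.norm_eq_abs, abs_of_nonneg (Real.exp_pos _).le, Real.exp_le_one_iff]
    nlinarith
  -- Dominated convergence: the difference quotients are bounded by the integrable function x.
  have key : Tendsto (fun u : ℝ => ∫ x, u⁻¹ * (Real.exp (-u * x) - 1) ∂ν) (𝓝[>] 0)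
      (𝓝 (∫ x, -x ∂ν)) := by
    refine tendsto_integral_filter_of_dominated_convergence (fun x => x)
      (Eventually.of_forall fun u => by fun_prop) ?_ hi ?_
    · filter_upwards [self_mem_nhdsWithin] with u hu
      have hu : (0 : ℝ) < u := hu
      filter_upwards [h0] with x hx
      rw [norm_mul, norm_inv, Real.norm_eq_abs, abs_of_pos hu, inv_mul_le_iff₀ hu]
      exact hb u hu x hx
    · refine ae_of_all _ fun x => ?_
      have hd : HasDerivAt (fun u : ℝ => Real.exp (-u * x)) (-x) 0 := by
        have := ((hasDerivAt_id (0 : ℝ)).neg.mul_const x).exp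
        simpa using this
      have := hd.hasDerivWithinAt (s := Set.Ioi 0)
      rw [hasDerivWithinAt_iff_tendsto_slope' (by simp)] at this
      refine this.congr fun u => ?_
      simp [slope_def_field, div_eq_inv_mul]
  refine key.congr' ?_
  filter_upwards [self_mem_nhdsWithin] with u hu
  have hu : (0 : ℝ) < u := hu
  rw [integral_const_mul, integral_sub (hI u hu.le) (integrable_const _)]
  simp [slope_def_field, div_eq_inv_mul]

/-- The mean of a law whose Laplace transform satisfies the limiting functional equation. -/
lemma integral_eq_of_laplace (h0 : ∀ᵐ x ∂ν, 0 ≤ x) (hi : Integrable (fun x : ℝ => x) ν)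
    {cbar g β : ℝ} (hg : 0 ≤ g) (hβ : 0 ≤ β) (hgβ : g + β < 1)
    (h : ∀ z : ℂ, z.re ≤ 0 → ∫ x : ℝ, Complex.exp (z * x) ∂ν
      = Complex.exp (z * cbar) * ∫ x : ℝ, Complex.exp (expMap g β z * x) ∂ν) :
    ∫ x, x ∂ν = cbar / (1 - g - β) := by
  set L : ℝ → ℝ := fun u => ∫ x, Real.exp (-u * x) ∂ν
  set τ : ℝ → ℝ := fun u => β * u + (1 - Real.exp (-(g * u)))
  have hL : ∀ u : ℝ, ∫ x : ℝ, Complex.exp ((-u : ℝ) * x) ∂ν = (L u : ℝ) := by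
    intro u
    simp only [L]
    rw [← integral_complex_ofReal]
    push_cast
    rfl
  have hτ : ∀ u, 0 ≤ u → 0 ≤ τ u := fun u hu => by
    have : Real.exp (-(g * u)) ≤ 1 := Real.exp_le_one_iff.2 (by nlinarith)
    have := mul_nonneg hβ hu
    simp only [τ]; linarith
  have heq : ∀ u ∈ Set.Ici (0 : ℝ), L u = Real.exp (-u * cbar) * L (τ u) := by
    intro u hu
    have hu : 0 ≤ u := hu
    have e := h ((-u : ℝ) : ℂ) (by simpa using hu)
    have e2 : expMap g β ((-u : ℝ) : ℂ) = ((-(τ u) : ℝ) : ℂ) := by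
      simp only [expMap, τ]; push_cast; ring_nf
    rw [e2, hL, hL] at e
    have e3 : Complex.exp (((-u : ℝ) : ℂ) * cbar) = (Real.exp (-u * cbar) : ℝ) := by push_cast; rfl
    rw [e3] at e
    exact_mod_cast e
  have hτ0 : τ 0 = 0 := by simp [τ]
  have hL0 : L 0 = 1 := by simp [L]
  have hdL := hasDerivWithinAt_laplace h0 hi
  set m := ∫ x, x ∂ν
  have hdτ : HasDerivWithinAt τ (β + g) (Set.Ici 0) 0 := by
    have h1 : HasDerivAt (fun u : ℝ => Real.exp (-(g * u))) (-g) 0 := by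
      have := (((hasDerivAt_id (0 : ℝ)).const_mul g).neg).exp
      simpa using this
    have h2 := ((hasDerivAt_id (0 : ℝ)).const_mul β).add ((hasDerivAt_const (0 : ℝ) (1 : ℝ)).sub h1)
    have h3 : HasDerivAt τ (β * 1 + (0 - -g)) 0 := h2
    exact (h3.congr_deriv (by ring)).hasDerivWithinAt
  have hdc : HasDerivWithinAt (fun u => L (τ u)) (-m * (β + g)) (Set.Ici 0) 0 := by
    refine HasDerivWithinAt.comp (h₂ := L) (h := τ) (s' := Set.Ici 0) 0 ?_ hdτ fun u hu => hτ u hu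
    rw [hτ0]; exact hdL
  have hde : HasDerivWithinAt (fun u : ℝ => Real.exp (-u * cbar)) (-cbar) (Set.Ici 0) 0 := by
    have := ((hasDerivAt_id (0 : ℝ)).neg.mul_const cbar).exp
    have h3 : HasDerivAt (fun u : ℝ => Real.exp (-u * cbar)) (-cbar) 0 := by simpa using this
    exact h3.hasDerivWithinAt
  -- Differentiating both sides of L(u) = exp(-u cbar) L(τ u) at 0 from the right gives -m = -cbar -
  -- m(β + g).
  have hd := (hde.mul hdc).congr (f₁ := L) heq (heq 0 (by simp))
  have := (uniqueDiffWithinAt_Ici (0 : ℝ)).eq_deriv _ hdL hd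
  simp only [hτ0, hL0] at this
  rw [eq_div_iff (by linarith)]
  norm_num at this
  linarith

end Laplace

end InteractiveGAB

/-! ### Tightness and convergence in law. -/

namespace InteractiveGAB

open RareBounds

/-- Markov's inequality, uniformly over the set. -/
lemma isTightMeasureSet_of_mean_le {S : Set (Measure ℝ)} {K : ℝ} (hS : ∀ ν ∈ S,
      IsProbabilityMeasure ν ∧ (∀ᵐ x ∂ν, 0 ≤ x) ∧ Integrable (fun x : ℝ => x) ν ∧ ∫ x, x ∂ν ≤ K) :
    IsTightMeasureSet S := by
  refine isTightMeasureSet_of_tendsto_measure_norm_gt ?_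
  have hlim : Tendsto (fun r : ℝ => ENNReal.ofReal (K / r)) atTop (𝓝 0) := by
    have := ENNReal.tendsto_ofReal (tendsto_id.const_div_atTop K)
    simpa using this
  refine tendsto_of_tendsto_of_tendsto_of_le_of_le' tendsto_const_nhds hlim
    (Eventually.of_forall fun _ => zero_le) ?_
  filter_upwards [eventually_gt_atTop 0] with r hr
  refine iSup₂_le fun ν hν => ?_
  obtain ⟨_, h0, hi, hK⟩ := hS ν hν
  have h1 := mul_meas_ge_le_integral_of_nonneg h0 hi r
  have h2 : ν {x | r < ‖x‖} ≤ ν {x | r ≤ x} := by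
    refine measure_mono_ae ?_
    filter_upwards [h0] with x hx hrx
    have hrx : r < ‖x‖ := hrx
    rw [Real.norm_eq_abs, abs_of_nonneg hx] at hrx
    exact hrx.le
  refine h2.trans ?_
  rw [← ofReal_measureReal]
  refine ENNReal.ofReal_le_ofReal ?_
  rw [le_div_iff₀ hr]
  linarith

section Limit

variable {ι : Type*} {l : Filter ι} [l.NeBot] {ν : ι → ProbabilityMeasure ℝ} {ν' : ProbabilityMeasure ℝ}

lemma ae_nonneg_of_tendsto (h : Tendsto ν l (𝓝 ν')) (h0 : ∀ n, ∀ᵐ x ∂(ν n : Measure ℝ), 0 ≤ x) :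
    ∀ᵐ x ∂(ν' : Measure ℝ), 0 ≤ x := by
  have e : ∀ ρ : Measure ℝ, (∀ᵐ x ∂ρ, 0 ≤ x) ↔ ρ (Set.Iio 0) = 0 := fun ρ => by
    rw [ae_iff]; simp only [not_le]; rfl
  have := ProbabilityMeasure.le_liminf_measure_open_of_tendsto h (G := Set.Iio 0) isOpen_Iio
  simp only [(e _).1 (h0 _), liminf_const] at this
  exact (e _).2 (le_antisymm this zero_le)

/-- The exponentials exp(zx) are bounded only for x ≥ 0; composing with max x 0 gives a bounded
continuous function on the line with the same integrals. -/
lemma tendsto_integral_of_nonneg {E : Type*} [RCLike E] (h : Tendsto ν l (𝓝 ν'))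
    (h0 : ∀ n, ∀ᵐ x ∂(ν n : Measure ℝ), 0 ≤ x) {f : ℝ → E} (hf : Continuous f) {K : ℝ}
    (hK : ∀ x, 0 ≤ x → ‖f x‖ ≤ K) :
    Tendsto (fun n => ∫ x, f x ∂(ν n : Measure ℝ)) l (𝓝 (∫ x, f x ∂(ν' : Measure ℝ))) := by
  let F : BoundedContinuousFunction ℝ E := BoundedContinuousFunction.ofNormedAddCommGroup
    (fun x => f (max x 0)) (hf.comp (by fun_prop)) K fun x => hK _ (le_max_right _ _)
  have e : ∀ ρ : Measure ℝ, (∀ᵐ x ∂ρ, 0 ≤ x) → ∫ x, F x ∂ρ = ∫ x, f x ∂ρ := by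
    intro ρ hρ
    refine integral_congr_ae ?_
    filter_upwards [hρ] with x hx
    change f (max x 0) = f x
    rw [max_eq_left hx]
  have := (ProbabilityMeasure.tendsto_iff_forall_integral_rclike_tendsto E).1 h F
  rw [e _ (ae_nonneg_of_tendsto h h0)] at this
  exact this.congr fun n => e _ (h0 n)

/-- The mean is lower semicontinuous. -/
lemma integrable_of_tendsto (h : Tendsto ν l (𝓝 ν'))
    (h0 : ∀ n, ∀ᵐ x ∂(ν n : Measure ℝ), 0 ≤ x)
    (hi : ∀ n, Integrable (fun x : ℝ => x) (ν n : Measure ℝ)) {K : ℝ}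
    (hK : ∀ n, ∫ x, x ∂(ν n : Measure ℝ) ≤ K) : Integrable (fun x : ℝ => x) (ν' : Measure ℝ) := by
  have h0' := ae_nonneg_of_tendsto h h0
  -- Truncations are bounded and continuous, so the bound K passes to the limit law; Fatou's lemma
  -- then removes the truncation.
  have hB : ∀ B : ℕ, ∫ x : ℝ, min x B ∂(ν' : Measure ℝ) ≤ K := by
    intro B
    have ht := tendsto_integral_of_nonneg (E := ℝ) h h0 (f := fun x => min x B) (by fun_prop)
      (K := B) fun x hx => by
        rw [Real.norm_eq_abs, abs_of_nonneg (le_min hx B.cast_nonneg)]; exact min_le_right _ _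
    refine le_of_tendsto ht (Eventually.of_forall fun n => le_trans ?_ (hK n))
    exact integral_mono_of_nonneg ((h0 n).mono fun x hx => le_min hx B.cast_nonneg) (hi n)
      (ae_of_all _ fun x => min_le_left _ _)
  refine ⟨by fun_prop, ?_⟩
  have e1 : ∀ᵐ x ∂(ν' : Measure ℝ),
      liminf (fun B : ℕ => ENNReal.ofReal (min x B)) atTop = ‖x‖ₑ := by
    filter_upwards [h0'] with x hx
    have : Tendsto (fun B : ℕ => ENNReal.ofReal (min x B)) atTop (𝓝 ‖x‖ₑ) := by
      refine tendsto_const_nhds.congr' ?_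
      filter_upwards [eventually_ge_atTop ⌈x⌉₊] with B hBx
      rw [min_eq_left (Nat.ceil_le.1 hBx), Real.enorm_of_nonneg hx]
    exact this.liminf_eq
  rw [HasFiniteIntegral, ← lintegral_congr_ae e1]
  refine (lintegral_liminf_le fun B => by fun_prop).trans_lt
    (lt_of_le_of_lt ?_ (ENNReal.ofReal_lt_top (r := K)))
  refine liminf_le_of_le (by isBoundedDefault) fun b hb => ?_
  obtain ⟨B, hB'⟩ := hb.exists
  refine hB'.trans ?_
  rw [← ofReal_integral_eq_lintegral_ofReal]
  · exact ENNReal.ofReal_le_ofReal (hB B)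
  · refine Integrable.of_bound (C := B) (by fun_prop) ?_
    filter_upwards [h0'] with x hx
    rw [Real.norm_eq_abs, abs_of_nonneg (le_min hx B.cast_nonneg)]
    exact min_le_right _ _
  · filter_upwards [h0'] with x hx using le_min hx B.cast_nonneg

end Limit

/-- Laws that asymptotically satisfy the functional equation of the Poisson autoregression
converge. -/
theorem exists_tendsto_of_laplace {ν : ℕ → ProbabilityMeasure ℝ} {cbar g β K : ℝ} (hc : 0 ≤ cbar)
    (hg : 0 ≤ g) (hβ : 0 ≤ β) (hgβ : g + β < 1)
    (h0 : ∀ n, ∀ᵐ x ∂(ν n : Measure ℝ), 0 ≤ x)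
    (hi : ∀ n, Integrable (fun x : ℝ => x) (ν n : Measure ℝ))
    (hK : ∀ n, ∫ x, x ∂(ν n : Measure ℝ) ≤ K)
    (h : ∀ z : ℂ, z.re ≤ 0 → Tendsto (fun n => ‖∫ x : ℝ, Complex.exp (z * x) ∂(ν n : Measure ℝ)
      - Complex.exp (z * cbar) * ∫ x : ℝ, Complex.exp (expMap g β z * x) ∂(ν n : Measure ℝ)‖)
      atTop (𝓝 0)) :
    ∃ ν' : ProbabilityMeasure ℝ, Tendsto ν atTop (𝓝 ν') ∧
      Integrable (fun x : ℝ => x) (ν' : Measure ℝ) ∧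
      ∫ x, x ∂(ν' : Measure ℝ) = cbar / (1 - g - β) := by
  have htight : IsTightMeasureSet {((μ : ProbabilityMeasure ℝ) : Measure ℝ) | μ ∈ Set.range ν} := by
    refine isTightMeasureSet_of_mean_le (K := K) ?_
    rintro _ ⟨_, ⟨n, rfl⟩, rfl⟩
    exact ⟨inferInstance, h0 n, hi n, hK n⟩
  -- One subsequential limit suffices. It only supplies an exact solution of the functional
  -- equation; the claim below compares the whole sequence with it.
  obtain ⟨ν', -, φ, hφ, hlim⟩ := (isCompact_closure_of_isTightMeasureSet htight).tendsto_subseq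
    fun n => subset_closure (Set.mem_range_self (f := ν) n)
  have h0' := ae_nonneg_of_tendsto hlim fun n => h0 (φ n)
  have hi' := integrable_of_tendsto hlim (fun n => h0 (φ n)) (fun n => hi (φ n)) fun n => hK (φ n)
  have hψ : ∀ z : ℂ, z.re ≤ 0 →
      Tendsto (fun n => ∫ x : ℝ, Complex.exp (z * x) ∂(ν (φ n) : Measure ℝ)) atTop
        (𝓝 (∫ x : ℝ, Complex.exp (z * x) ∂(ν' : Measure ℝ))) := fun z hz =>
    tendsto_integral_of_nonneg (E := ℂ) hlim (fun n => h0 (φ n)) (by fun_prop) (K := 1)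
      fun x hx => norm_exp_le_one (re_mul_nonpos hz hx)
  have hfun : ∀ z : ℂ, z.re ≤ 0 → ∫ x : ℝ, Complex.exp (z * x) ∂(ν' : Measure ℝ)
      = Complex.exp (z * cbar) * ∫ x : ℝ, Complex.exp (expMap g β z * x) ∂(ν' : Measure ℝ) := by
    intro z hz
    have a := ((hψ z hz).sub ((hψ _ (expMap_re hg hβ hz)).const_mul (Complex.exp (z * cbar)))).norm
    have b := (h z hz).comp hφ.tendsto_atTop
    have := tendsto_nhds_unique a b
    exact sub_eq_zero.1 (norm_eq_zero.1 this)
  refine ⟨ν', ProbabilityMeasure.tendsto_iff_tendsto_charFun.2 fun t => ?_, hi',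
    integral_eq_of_laplace h0' hi' hg hβ hgβ hfun⟩
  set D : ℕ → ℂ → ℝ := fun n z => ‖∫ x : ℝ, Complex.exp (z * x) ∂(ν n : Measure ℝ)
    - ∫ x : ℝ, Complex.exp (z * x) ∂(ν' : Measure ℝ)‖
  set m := ∫ x, x ∂(ν' : Measure ℝ)
  have hρ : 0 ≤ g + β := by positivity
  have hm : 0 ≤ m := integral_nonneg_of_ae h0'
  have hK0 : 0 ≤ K := (integral_nonneg_of_ae (h0 0)).trans (hK 0)
  -- Each use of the functional equation moves the comparison from z to `expMap g β z`, at the price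
  -- of an error that vanishes in n. After k uses the argument has shrunk by (g + β) ^ k, and the
  -- transforms are compared with 1 there.
  have claim : ∀ k : ℕ, ∀ z : ℂ, z.re ≤ 0 → ∀ ε > 0, ∀ᶠ n in atTop,
      D n z ≤ ε + (g + β) ^ k * (‖z‖ * (K + m)) := by
    intro k
    induction k with
    | zero =>
      intro z hz ε hε
      refine Eventually.of_forall fun n => ?_
      have a := norm_integral_cexp_sub_one_le (h0 n) (hi n) hz
      have b := norm_integral_cexp_sub_one_le h0' hi' hz
      have e := norm_sub_le_norm_sub_add_norm_sub (∫ x : ℝ, Complex.exp (z * x) ∂(ν n : Measure ℝ)) 1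
        (∫ x : ℝ, Complex.exp (z * x) ∂(ν' : Measure ℝ))
      rw [norm_sub_rev 1] at e
      have f := mul_le_mul_of_nonneg_left (hK n) (norm_nonneg z)
      rw [pow_zero, one_mul, mul_add]
      simp only [D]
      linarith
    | succ k ih =>
      intro z hz ε hε
      filter_upwards [ih _ (expMap_re hg hβ hz) (ε / 2) (by positivity),
        (h z hz).eventually_le_const (by positivity : (0 : ℝ) < ε / 2)] with n h1 h2
      have e1 := norm_sub_le_norm_sub_add_norm_sub
        (∫ x : ℝ, Complex.exp (z * x) ∂(ν n : Measure ℝ))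
        (Complex.exp (z * cbar) * ∫ x : ℝ, Complex.exp (expMap g β z * x) ∂(ν n : Measure ℝ))
        (∫ x : ℝ, Complex.exp (z * x) ∂(ν' : Measure ℝ))
      rw [hfun z hz, ← mul_sub, norm_mul] at e1
      have e2 := mul_le_of_le_one_left (norm_nonneg
        (∫ x : ℝ, Complex.exp (expMap g β z * x) ∂(ν n : Measure ℝ)
          - ∫ x : ℝ, Complex.exp (expMap g β z * x) ∂(ν' : Measure ℝ)))
        (norm_exp_le_one (re_mul_nonpos hz hc))
      have e3 : (g + β) ^ k * (‖expMap g β z‖ * (K + m)) ≤ (g + β) ^ (k + 1) * (‖z‖ * (K + m)) := by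
        rw [pow_succ, mul_assoc, ← mul_assoc (g + β)]
        gcongr
        exact norm_expMap_le hg hβ hz
      simp only [D] at h1 ⊢
      rw [hfun z hz]
      linarith
  have hz : ((t : ℂ) * Complex.I).re ≤ 0 := by simp
  have hD : Tendsto (fun n => D n (t * Complex.I)) atTop (𝓝 0) := by
    have hpow : Tendsto (fun k : ℕ => (g + β) ^ k * (‖(t : ℂ) * Complex.I‖ * (K + m))) atTop (𝓝 0) := by
      simpa using (tendsto_pow_atTop_nhds_zero_of_lt_one hρ hgβ).mul_const
        (‖(t : ℂ) * Complex.I‖ * (K + m))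
    refine Metric.tendsto_atTop'.2 fun ε hε => ?_
    obtain ⟨k, hk⟩ := (hpow.eventually_lt_const (by positivity : 0 < ε / 2)).exists
    obtain ⟨n₀, hn₀⟩ := eventually_atTop.1 (claim k _ hz (ε / 2) (by positivity))
    refine ⟨n₀, fun n hn => ?_⟩
    rw [Real.dist_eq, sub_zero, abs_of_nonneg (norm_nonneg _)]
    have := hn₀ n hn.le
    linarith
  have e : ∀ ρ : ProbabilityMeasure ℝ, charFun (ρ : Measure ℝ) t
      = ∫ x : ℝ, Complex.exp (t * Complex.I * x) ∂(ρ : Measure ℝ) := by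
    intro ρ
    rw [charFun_apply_real]
    simp only [mul_right_comm]
  simp only [e]
  exact tendsto_iff_norm_sub_tendsto_zero.2 hD

end InteractiveGAB

/-! ### Conclusion for sequences of stationary solutions. -/

namespace InteractiveGAB

namespace RareBounds

variable {c a γ : ℕ → ℝ} {β κ C Cbar : ℝ}

lemma hasUniqueStationarySolution (H : RareBounds c a γ β κ C Cbar) {N : ℕ} (hN : H.Large N) :
    HasUniqueStationarySolution (rareEvents c a γ β κ N) := by
  have h0 := H.Cbar_nonneg
  have h1 := H.lt_one
  exact Params.hasUniqueStationarySolution (H.admissible hN) (by linarith) (by linarith)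
    (H.contracting hN)

lemma limit_c_nonneg (H : RareBounds c a γ β κ C Cbar) {cbar : ℝ}
    (hc : Tendsto (avg c) atTop (𝓝 cbar)) : 0 ≤ cbar :=
  ge_of_tendsto hc ((eventually_gt_atTop 0).mono fun _ hN => (H.avg_c_mem hN).1)

lemma limit_γ_mem (H : RareBounds c a γ β κ C Cbar) {g : ℝ}
    (hg : Tendsto (avg γ) atTop (𝓝 g)) : g ∈ Set.Icc 0 (Cbar - β) :=
  isClosed_Icc.mem_of_tendsto hg ((eventually_gt_atTop 0).mono fun _ hN => H.avg_γ_mem hN)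

/-- The law of the sum of the success probabilities at time `0` under a law on trajectories. -/
noncomputable def sumLaw {N : ℕ} (P : Measure (Path N)) : Measure ℝ :=
  P.map fun x => ∑ i, (x 0).1 i

lemma measurable_sum {N : ℕ} : Measurable fun x : Path N => ∑ i, (x 0).1 i := by fun_prop

/-- The sums of the success probabilities of stationary solutions converge in law. -/
theorem exists_tendsto_sumLaw (H : RareBounds c a γ β κ C Cbar) {cbar g : ℝ}
    (hc : Tendsto (avg c) atTop (𝓝 cbar)) (hg : Tendsto (avg γ) atTop (𝓝 g)) {N₀ : ℕ}
    (hN : ∀ n, H.Large (n + N₀)) {P : ∀ n, Measure (Path (n + N₀))} [∀ n, IsProbabilityMeasure (P n)]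
    (hP : ∀ n, IsStationarySolution (rareEvents c a γ β κ (n + N₀)) (P n)
      (fun t x => (x t).1) fun t x => (x t).2) {ν : ℕ → ProbabilityMeasure ℝ}
    (hν : ∀ n, (ν n : Measure ℝ) = sumLaw (P n)) :
    ∃ ν' : ProbabilityMeasure ℝ, Tendsto ν atTop (𝓝 ν') ∧
      Integrable (fun x : ℝ => x) (ν' : Measure ℝ) ∧
      ∫ x, x ∂(ν' : Measure ℝ) = cbar / (1 - g - β) := by
  have hgm := H.limit_γ_mem hg
  have hcn := H.limit_c_nonneg hc
  have hmap : ∀ n (w : ℂ), ∫ x : ℝ, Complex.exp (w * x) ∂sumLaw (P n)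
      = ∫ x : Path (n + N₀), Complex.exp (w * (∑ i, (x 0).1 i : ℝ)) ∂P n := fun n w =>
    integral_map measurable_sum.aemeasurable (by fun_prop)
  have hid : ∀ n, Integrable (fun x : Path (n + N₀) => ∑ i, (x 0).1 i) (P n) := fun n =>
    (hP n).integrable_comp 0 (w := fun x : Fin (n + N₀) → ℝ => ∑ i, x i) (by fun_prop)
  refine exists_tendsto_of_laplace (K := H.meanBound) hcn hgm.1 H.β_nonneg
    (by have := hgm.2; have := H.lt_one; linarith) (fun n => ?_) (fun n => ?_) (fun n => ?_)
    fun z hz => ?_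
  · rw [hν, sumLaw, ae_map_iff measurable_sum.aemeasurable measurableSet_Ici]
    exact ((hP n).mem_cube 0).mono fun _ => sum_nonneg_of_mem_cube
  · rw [hν, sumLaw, integrable_map_measure (by fun_prop) measurable_sum.aemeasurable]
    exact hid n
  · rw [hν, sumLaw, integral_map measurable_sum.aemeasurable (by fun_prop)]
    exact H.mean_le (hN n) (hP n)
  · refine squeeze_zero (fun _ => norm_nonneg _) (fun n => ?_)
      ((H.tendsto_expError hc hg z).comp (tendsto_add_atTop_nat N₀))
    rw [hν, hmap, hmap]
    exact H.norm_integral_exp_sub_le (hN n) (hP n) hcn hgm.1 hz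

section Sequence

variable {Ω : ℕ → Type*} [∀ N, MeasurableSpace (Ω N)] {μ : ∀ N, Measure (Ω N)}
  [∀ N, IsProbabilityMeasure (μ N)] {p : ∀ N, ℤ → Ω N → Fin N → ℝ}
  {y : ∀ N, ℤ → Ω N → Fin N → Bool}

/-- Convergence in law alone does not give convergence of means. The mean equation does so directly:
it confines (1 - avg γ N - β) times the mean between two sequences tending to cbar. -/
lemma tendsto_mean (H : RareBounds c a γ β κ C Cbar) {cbar g : ℝ}
    (hc : Tendsto (avg c) atTop (𝓝 cbar)) (hg : Tendsto (avg γ) atTop (𝓝 g))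
    (h : ∀ᶠ N in atTop, IsStationarySolution (rareEvents c a γ β κ N) (μ N) (p N) (y N)) :
    Tendsto (fun N => ∑ i, ∫ ω, p N 0 ω i ∂(μ N)) atTop (𝓝 (cbar / (1 - g - β))) := by
  have hgm := H.limit_γ_mem hg
  have h1 := H.lt_one
  have hden : Tendsto (fun N => 1 - avg γ N - β) atTop (𝓝 (1 - g - β)) :=
    (hg.const_sub 1).sub_const β
  have hup : Tendsto (fun N : ℕ => avg c N + C / (N : ℝ) ^ κ * H.meanBound) atTop (𝓝 cbar) := by
    have := (tendsto_one_div_rpow H.κ_pos).const_mul C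
    simp only [mul_one_div, mul_zero] at this
    simpa using hc.add (this.mul_const H.meanBound)
  have hnum : Tendsto (fun N => (1 - avg γ N - β) * ∫ ω, ∑ i, p N 0 ω i ∂(μ N)) atTop (𝓝 cbar) := by
    refine tendsto_of_tendsto_of_tendsto_of_le_of_le' hc hup ?_ ?_
    · filter_upwards [h, H.eventually_large] with N hs hN using (H.abs_mean_sub_le hN hs).1
    · filter_upwards [h, H.eventually_large] with N hs hN
      refine (H.abs_mean_sub_le hN hs).2.trans ?_
      gcongr
      · exact (H.large_bounds hN).2.1
      · exact H.mean_le hN hs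
  refine (hnum.div hden (by have := hgm.2; linarith)).congr' ?_
  filter_upwards [h, H.eventually_large] with N hs hN
  have hd : 1 - avg γ N - β ≠ 0 := by have := (H.avg_γ_mem hN.1).2; linarith
  rw [Pi.div_apply, mul_div_cancel_left₀ _ hd]
  exact integral_finsetSum _ fun i _ =>
    hs.integrable_comp 0 (w := fun x : Fin N → ℝ => x i) (by fun_prop)

/-- Markov's inequality for the supremum norm, whose mean is O(rate). -/
lemma tendsto_max (H : RareBounds c a γ β κ C Cbar)
    (h : ∀ᶠ N in atTop, IsStationarySolution (rareEvents c a γ β κ N) (μ N) (p N) (y N))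
    {ε : ℝ} (hε : 0 < ε) : Tendsto (fun N => μ N {ω | ε ≤ |⨆ i, p N 0 ω i|}) atTop (𝓝 0) := by
  have hlim : Tendsto (fun N => ENNReal.ofReal (H.normBound * rate κ N / ε)) atTop (𝓝 0) := by
    simpa using ENNReal.tendsto_ofReal
      (((tendsto_rate H.κ_pos).const_mul H.normBound).div_const ε)
  refine tendsto_of_tendsto_of_tendsto_of_le_of_le' tendsto_const_nhds hlim
    (Eventually.of_forall fun _ => zero_le) ?_
  filter_upwards [h, H.eventually_large] with N hs hN
  have h1 : μ N {ω | ε ≤ |⨆ i, p N 0 ω i|} ≤ μ N {ω | ε ≤ ‖p N 0 ω‖} := by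
    refine measure_mono_ae ?_
    filter_upwards [hs.mem_cube 0] with ω hω hle
    have hle : ε ≤ |⨆ i, p N 0 ω i| := hle
    rw [abs_of_nonneg (Real.iSup_nonneg fun i => (hω i).1)] at hle
    exact hle.trans (Real.iSup_le (fun i => (le_abs_self _).trans (norm_le_pi_norm (p N 0 ω) i))
      (norm_nonneg _))
  refine h1.trans ?_
  rw [← ofReal_measureReal]
  refine ENNReal.ofReal_le_ofReal ?_
  rw [le_div_iff₀ hε]
  have h2 := mul_meas_ge_le_integral_of_nonneg (ae_of_all _ fun ω => norm_nonneg (p N 0 ω))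
    (hs.integrable_comp 0 continuous_norm) ε
  have h3 := H.integral_norm_le hN hs
  linarith

end Sequence

end RareBounds

end InteractiveGAB

theorem mainTheorem8 (c a γ : ℕ → ℝ) (β κ C Cbar cbar γbar : ℝ)
    (hκ : 0 < κ)
    (hc : ∀ i, 0 ≤ c i ∧ c i ≤ C) (ha : ∀ i, 0 ≤ a i ∧ a i ≤ C)
    (hγ : ∀ i, 0 ≤ γ i) (hβ : 0 ≤ β)
    (hCbar : Cbar < 1) (hβγ : ∀ i, β + γ i < Cbar)
    (hcbar : Tendsto (fun N : ℕ => (1 / (N : ℝ)) * ∑ i ∈ Finset.range N, c i) atTop (𝓝 cbar))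
    (hγbar : Tendsto (fun N : ℕ => (1 / (N : ℝ)) * ∑ i ∈ Finset.range N, γ i) atTop (𝓝 γbar)) :
    (∀ᶠ N in atTop,
      (InteractiveGAB.rareEvents c a γ β κ N).Admissible ∧
      InteractiveGAB.HasUniqueStationarySolution (InteractiveGAB.rareEvents c a γ β κ N)) ∧
    ∃ (ν : Measure ℝ) (_ : IsProbabilityMeasure ν),
      ∀ (Ω : ℕ → Type*) [∀ N, MeasurableSpace (Ω N)]
        (μ : ∀ N, Measure (Ω N)) [∀ N, IsProbabilityMeasure (μ N)]
        (p : ∀ N, ℤ → Ω N → Fin N → ℝ) (y : ∀ N, ℤ → Ω N → Fin N → Bool),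
        (∀ N t, Measurable (p N t)) →
        (∀ᶠ N in atTop, InteractiveGAB.IsStationarySolution
          (InteractiveGAB.rareEvents c a γ β κ N) (μ N) (p N) (y N)) →
        InteractiveGAB.InitialCondition μ (fun N => p N 0) ν := by
  have H : InteractiveGAB.RareBounds c a γ β κ C Cbar := ⟨hκ, hc, ha, hγ, hβ, hCbar, hβγ⟩
  refine ⟨H.eventually_large.mono fun N hN =>
    ⟨H.admissible hN, H.hasUniqueStationarySolution hN⟩, ?_⟩
  have hc' : Tendsto (InteractiveGAB.avg c) atTop (𝓝 cbar) := hcbar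
  have hg' : Tendsto (InteractiveGAB.avg γ) atTop (𝓝 γbar) := hγbar
  obtain ⟨N₀, hN₀⟩ := eventually_atTop.1 H.eventually_large
  have hN : ∀ n, H.Large (n + N₀) := fun n => hN₀ _ (Nat.le_add_left _ _)
  choose P hP hs hu using fun n => H.hasUniqueStationarySolution (hN n)
  let ν : ℕ → ProbabilityMeasure ℝ := fun n => ⟨InteractiveGAB.RareBounds.sumLaw (P n),
    Measure.isProbabilityMeasure_map InteractiveGAB.RareBounds.measurable_sum.aemeasurable⟩
  obtain ⟨ν', hlim, hint, hmean⟩ := H.exists_tendsto_sumLaw hc' hg' hN hs (ν := ν) fun _ => rfl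
  refine ⟨ν', inferInstance, fun Ω _ μ _ p y hp hstat => ?_⟩
  -- Convergence in distribution asks for measurability at every N, whereas the stationary solutions
  -- provide it only for large N.
  have hsum : ∀ N, Measurable fun ω => ∑ i, p N 0 ω i := fun N =>
    Finset.measurable_sum _ fun i _ => (measurable_pi_apply i).comp (hp N 0)
  refine ⟨⟨fun N => (hsum N).aemeasurable, by fun_prop, ?_⟩, hint, ?_, fun ε hε =>
    H.tendsto_max hstat hε⟩
  · have hid : (⟨(ν' : Measure ℝ).map fun x : ℝ => x,
        Measure.isProbabilityMeasure_map (by fun_prop)⟩ : ProbabilityMeasure ℝ) = ν' :=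
      Subtype.ext Measure.map_id
    rw [hid]
    refine (tendsto_add_atTop_iff_nat N₀).1 (hlim.congr' ?_)
    -- By uniqueness the given solution has the trajectory law P n, so its sum has the law from
    -- which the limit was constructed.
    filter_upwards [(tendsto_add_atTop_nat N₀).eventually hstat] with n hn
    refine Subtype.ext ?_
    change InteractiveGAB.RareBounds.sumLaw (P n) = _
    rw [InteractiveGAB.RareBounds.sumLaw, ← hu n _ _ _ _ hn,
      Measure.map_map InteractiveGAB.RareBounds.measurable_sum hn.measurable_trajectory]
    rfl
  · rw [hmean]
    exact H.tendsto_mean hc' hg' hstat
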